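/- **Setting.** Fix a first-order signature whose only predicate is equality $\approx$, and an infinite set of variables. Literals are $s\approx t$ and $s\not\approx t$ (written $s\,\#\,t$), with unordered sides; clauses are finite multisets (disjunctions) of literals; $\mathrm{comp}$ is the complement; $\models$ is first-order entailment. Positions, $t|_p$, $t[s]_p$ and most general unifiers (idempotent, introducing no fresh variables) are as usual; $C\cdot\sigma$ is a closure, $\sigma$ grounding for $C$. Let $\prec_T$ be a well-founded rewrite ordering on terms, total on ground terms, with only finitely many ground terms below each ground term. It is extended to literals by the multiset extension, with $s\approx t\mapsto\{s,t\}$ and $s\not\approx t\mapsto\{s,s,t,t\}$, and literals and clauses are compared with a term $\beta$ through $\{\beta\}$ and $\{\{\beta\}\}$. For a set $\Gamma$ of ground literals, $\mathrm{conv}(\Gamma)$ is a convergent rewrite system for the positive equations of $\Gamma$, oriented by $\prec_T$. A substitution is irreducible if all terms of its codomain are. **Trails.** A trail is a sequence $\Gamma=[L_1^{i_1:C_1\cdot\sigma_1},\dots,L_n^{i_n:C_n\cdot\sigma_n}]$ of ground literals with levels $i_j\in\mathbb N$ and closures ($L_j$ is the instance under $\sigma_j$ of a distinguished literal of $C_j$).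 A ground literal $L$ is true (false) in $\Gamma$ if $\Gamma\models L$ ($\Gamma\models\mathrm{comp}(L)$), defined if it is true or false, otherwise undefined. For a ground term $\beta$, $L$ is $\beta$-true / $\beta$-false / $\beta$-defined if $L\prec_T\beta$ and $L$ is true / false / defined, and $\beta$-undefined if $\beta\prec_T L$ or $L$ is undefined. A ground clause is $\beta$-true if some literal is, $\beta$-false if all literals are, and $\beta$-undefined otherwise. A core of a defined $L$ is a minimal subsequence of $\Gamma$ in which $L$ is defined; the defining literal of $L$ is the last literal of a core whose last literal is earliest in $\Gamma$ (there is none if the only core is empty). The level of $L$ is its annotation if $L\in\Gamma$, otherwise the level of its defining literal, and $0$ if there is none. The level of a clause is the maximum of the levels of its literals ($0$ if it is empty). A trail literal is a decision literal if its level exceeds the level of its predecessor ($0$ if it is the first literal) by one. **Trail induced ordering.** Given $\Gamma$ and $\beta$, $\prec_{\Gamma^*}$ on ground literals is given as follows. Let $L_i$ be the trail literals, and call $M$ of index $i$ if $M$ is $\beta$-defined, $M\notin\Gamma\cup\mathrm{comp}(\Gamma)$ and $M$ has defining literal $L_i$. On $\beta$-defined literals of level $>0$: for $M$ of index $i$ and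 $M'$ of index $k$, $M\prec_{\Gamma^*}M'$ if $i<k$, or $i=k$ and $M\prec_T M'$; each of $L_i,\mathrm{comp}(L_i)$ is smaller than each of $L_j,\mathrm{comp}(L_j)$ if $i<j$; $L_i\prec_{\Gamma^*}\mathrm{comp}(L_i)$; $L_i$ and $\mathrm{comp}(L_i)$ are smaller than $M$ of index $k$ if $i\le k$, and greater than it if $k<i$. On $\beta$-defined literals of level $0$ it is $\prec_T$, and these are smaller than the $\beta$-defined literals of level $>0$. On $\beta$-undefined literals it is $\prec_T$, and $\beta$-defined literals are smaller than $\beta$-undefined ones. It is extended to ground clauses by multiset extension. **Reduction chains.** A rewrite step consists of a closure $(s\,\#\,t\lor C)\cdot\sigma$ with distinguished literal $s\,\#\,t$, and either two earlier rewrite steps and a position, or nothing (a leaf). From steps with closures $(l_1\approx r_1\lor C_1)\cdot\sigma_1$ and $(l_2\,\#\,r_2\lor C_2)\cdot\sigma_2$, renamed to be variable disjoint, with $r_1\sigma_1\prec_T l_1\sigma_1=(l_2\,\#\,r_2)\sigma_2|_p$, a rewrite inference yields the closure $((l_2\,\#\,r_2)\delta[r_1]_p\mu\lor C_1\mu\lor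 C_2\delta\mu)\cdot\sigma_1\sigma_2\rho$ with distinguished literal $(l_2\,\#\,r_2)\delta[r_1]_p\mu$, where $\mu=\mathrm{mgu}((l_2\,\#\,r_2)\delta|_p,l_1)$; here $\delta,\rho$ are identities if $p$ is a position of $l_2\,\#\,r_2$, and otherwise $\delta$ introduces only fresh variables, $(l_2\,\#\,r_2)\delta$ is the most general instance with position $p$ that still has $(l_2\,\#\,r_2)\sigma_2$ as an instance, and $\rho$ acts only on the fresh variables, with $(l_2\,\#\,r_2)\delta\sigma_2\rho=(l_2\,\#\,r_2)\sigma_2$. A reduction chain from a trail is a list of rewrite steps, each a leaf annotating a trail literal or inferred from two earlier members. A reduction chain application from $\Gamma$ to a closure with distinguished ground literal $K$ is a reduction chain from $\Gamma$ and this closure whose last ground literal is the $\mathrm{conv}(\Gamma)$-normal form of $K$, and which loses this property when any step is removed. A refutation from $\Gamma$ and a closure with $\beta$-false distinguished literal is such a chain whose last ground literal has the form $s\not\approx s$, and which loses this property when any step but the last is removed. **The calculus SCL(EQ).** States are tuples $(\Gamma;N;U;\beta;k;D)$: a trail, the sets of initial and learned clauses, a ground term, the decision level, and $D\in\{\top,\bot\}$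 or a closure. The initial state is $(\epsilon;N;\emptyset;\beta;0;\top)$. The rules are as follows; only the components that change are described. * *Propagate* ($D=\top$): there are $C_0\lor C_1\lor L\in N\cup U$ and a grounding $\sigma$, irreducible by $\mathrm{conv}(\Gamma)$, such that all literals of $C_0\sigma$ are false in $\Gamma$, all literals of $C_1\sigma$ equal $L\sigma$, $\mu$ is the mgu of $L$ and the literals of $C_1$, $L\sigma$ is $\beta$-undefined, $(C_0\lor L)\mu\sigma\prec_T\beta$, and there is a reduction chain application from $\Gamma$ to $(L\mu\lor C_0\mu)\cdot\sigma$ with last closure $(s\,\#\,t\lor C)\cdot\tau$. Append $(s\,\#\,t)\tau$ with level $k$ and this closure to $\Gamma$. * *Decide* ($D=\top$): there are $C_0\lor L\in N\cup U$ and a grounding $\sigma$, irreducible by $\mathrm{conv}(\Gamma)$, such that $C_0\sigma$ is $\beta$-undefined or $\beta$-true, $L\sigma$ is $\beta$-undefined, $(C_0\lor L)\sigma\prec_T\beta$, and there is a reduction chain application from $\Gamma$ to $(L\lor C_0)\cdot\sigma$ with last closure $(s\,\#\,t\lor C)\cdot\tau$. Append $(s\,\#\,t)\tau$ with level $k+1$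 and closure $(s\,\#\,t\lor\mathrm{comp}(s\,\#\,t))\cdot\tau$; $k$ becomes $k+1$. * *Conflict* ($D=\top$): there are $D'\in N\cup U$ and a grounding $\sigma$, irreducible by $\mathrm{conv}(\Gamma)$, with $D'\sigma$ $\beta$-false. $D$ becomes $\bot$ if $D'\sigma$ is of level $0$, else $D'\cdot\sigma$. * *Skip*: if the trail is $\Gamma',K^{l},L^{k}$, the status is $D\cdot\sigma$, and $D\sigma$ is $\beta$-false in $\Gamma',K$, delete $L$; $k$ becomes $l$. * *Explore-Refutation*: if the status is $(D\lor K)\cdot\sigma$, all literals of $D\sigma$ are $\prec_{\Gamma^*}K\sigma$, the last trail literal is the defining literal of $K\sigma$, and $(s_j\,\#\,t_j\lor C_j)\cdot\sigma_j$ occurs in a refutation from $\Gamma$ and $(K\lor D)\cdot\sigma$, with $(s_j\,\#\,t_j\lor C_j)\sigma_j\prec_{\Gamma^*}(D\lor K)\sigma$ and $\beta$-false, it becomes the status. * *Factorize*: $(D\lor L\lor L')\cdot\sigma$ with $L\sigma=L'\sigma$ becomes $(D\lor L)\mu\cdot\sigma$, $\mu=\mathrm{mgu}(L,L')$. *Equality-Resolution*: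 $(D\lor s\not\approx s')\cdot\sigma$ with $s\sigma=s'\sigma$ becomes $D\mu\cdot\sigma$, $\mu=\mathrm{mgu}(s,s')$. * *Backtrack*: if the status is $(D\lor L)\cdot\sigma$, $D\sigma$ is of level $<k$, and $\Gamma',K$ is the shortest prefix of the trail for which some ground instance of $D\lor L$ is $\beta$-false in $\Gamma',K$ but not in $\Gamma'$, then the trail becomes $\Gamma'$, $D\lor L$ is added to $U$, the status becomes $\top$, and $k$ becomes $j-i$, where $j$ is the level of $K$, and $i=1$ if $K$ is a decision literal, $i=0$ otherwise. * *Grow* ($D=\top$): the trail becomes empty, $k$ becomes $0$, and $\beta$ is replaced by a ground term $\beta'$ with $\beta\prec_T\beta'$. A run is a finite sequence of rule applications from an initial state. It is *regular* if (1) Conflict and Factorize have precedence over all other rules; (2) in states with $k=0$, Propagate has precedence over Decide; (3) if Propagate could append $L^{k:C\cdot\sigma}$ with $C\in N\cup U$, then Decide does not append $\mathrm{comp}(L)$; (4) between an application of Conflict and the Backtrack that ends its conflict resolution, Skip is applied at least once, unless Conflict was applied immediately after Decide; (5) if Conflict was applied immediately after Decide, then that Backtrack is only applied in a state with trail $\Gamma,L'$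 and status $D\cdot\sigma$ such that $L\sigma=\mathrm{comp}(L')$ for some $L\in D$. **Lemma (Unit Rewriting).** Let $(\Gamma;N;U;\beta;k;D)$ be a state resulting from a regular run, with $k>0$, and let $l\approx r\in N$ be a unit clause. Let $C\lor L[l']_p\in N$ with $l'=l\mu$ for a matcher $\mu$. Let $\sigma'$ be grounding for $C\lor L[l']_p$ and $\sigma$ grounding for $l\approx r$, with $l\sigma=l'\sigma'$ and $r\sigma\prec_T l\sigma$. Then $$C\sigma'\lor (L\sigma')[r\sigma]_p\;\prec_{\Gamma^*}\;(C\lor L[l']_p)\sigma'.$$ In particular, if $l\approx r$ and $C\lor L[l']_p$ have no variables in common, $\mu$ moves only variables of $l$, and $\sigma$ moves only variables of $l\approx r$, then $$(C\lor L[r\mu\sigma\sigma']_p)\sigma'\;\prec_{\Gamma^*}\;(C\lor L[l']_p)\sigma'.$$ -/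

import Mathlib

namespace SCLEQ

universe u v w

/-! ## Terms, substitutions, positions

Terms over the signature `L` with variables from `V` are Mathlib's first-order terms `L.Term V`.
The only predicate is equality, so relation symbols of `L` play no role. -/

/-- A substitution; it is applied with `Term.subst`. -/
abbrev Subst (L : FirstOrder.Language.{u, v}) (V : Type w) := V → L.Term V

/-- The domain of a substitution. -/
def Subst.dom {L : FirstOrder.Language.{u, v}} {V : Type w} (σ : Subst L V) : Set V :=
  {x | σ x ≠ FirstOrder.Language.Term.var x}

/-- Composition `στ`: first `σ`, then `τ`. -/
def Subst.comp {L : FirstOrder.Language.{u, v}} {V : Type w} (σ τ : Subst L V) : Subst L V :=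
  fun x => (σ x).subst τ

/-- The variables of a term. -/
def vars {L : FirstOrder.Language.{u, v}} {V : Type w} : L.Term V → Set V
  | .var x => {x}
  | .func _ ts => ⋃ i, vars (ts i)

/-- The subterm `t|_p`; it is `none` iff `p` is not a position of `t`. -/
def subtermAt {L : FirstOrder.Language.{u, v}} {V : Type w} : L.Term V → List ℕ → Option (L.Term V)
  | t, [] => some t
  | .var _, _ :: _ => none
  | .func (l := n) _ ts, i :: p => if h : i < n then subtermAt (ts ⟨i, h⟩) p else none

/-- The replacement `t[s]_p` (it is `t` itself if `p` is not a position of `t`). -/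
def replaceAt {L : FirstOrder.Language.{u, v}} {V : Type w} : L.Term V → List ℕ → L.Term V → L.Term V
  | _, [], s => s
  | .var x, _ :: _, _ => .var x
  | .func f ts, i :: p, s => .func f (fun j => if j.val = i then replaceAt (ts j) p s else ts j)

/-- `μ` is a most general unifier of the equations in `E`; mgus are idempotent and do not
introduce fresh variables. -/
def IsMGU {L : FirstOrder.Language.{u, v}} {V : Type w} (E : Set (L.Term V × L.Term V))
    (μ : Subst L V) : Prop :=
  (∀ e ∈ E, e.1.subst μ = e.2.subst μ) ∧
  (∀ θ : Subst L V, (∀ e ∈ E, e.1.subst θ = e.2.subst θ) → ∃ ρ : Subst L V, θ = μ.comp ρ) ∧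
  μ.comp μ = μ ∧
  (∀ x ∈ μ.dom, (∃ e ∈ E, x ∈ vars e.1 ∪ vars e.2) ∧
    ∀ y ∈ vars (μ x), ∃ e ∈ E, y ∈ vars e.1 ∪ vars e.2)

/-! ## Orderings -/

/-- The (Dershowitz-Manna) multiset extension of a relation. -/
def MulExt {α : Type*} (r : α → α → Prop) (M N : Multiset α) : Prop :=
  ∃ X Y Z : Multiset α, Y ≠ 0 ∧ M = Z + X ∧ N = Z + Y ∧ ∀ x ∈ X, ∃ y ∈ Y, r x y

/-- A desired term ordering: a well-founded rewrite ordering, total on ground terms, with only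
finitely many ground terms below each ground term. -/
structure IsDesired {L : FirstOrder.Language.{u, v}} {V : Type w} (lt : L.Term V → L.Term V → Prop) :
    Prop where
  wf : WellFounded lt
  trans : ∀ s t u, lt s t → lt t u → lt s u
  subst : ∀ (s t : L.Term V) (σ : Subst L V), lt s t → lt (s.subst σ) (t.subst σ)
  context : ∀ (s t c : L.Term V) (p : List ℕ), subtermAt c p ≠ none → lt s t →
    lt (replaceAt c p s) (replaceAt c p t)
  total : ∀ s t : L.Term V, vars s = ∅ → vars t = ∅ → lt s t ∨ s = t ∨ lt t s
  finite_below : ∀ t : L.Term V, vars t = ∅ → {s | vars s = ∅ ∧ lt s t}.Finite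

/-! ## Rewrite systems -/

/-- `s → t` by a rule of `R`. -/
def Rewrites {L : FirstOrder.Language.{u, v}} {V : Type w} (R : Set (L.Term V × L.Term V))
    (s t : L.Term V) : Prop :=
  ∃ e ∈ R, ∃ (p : List ℕ) (θ : Subst L V),
    subtermAt s p = some (e.1.subst θ) ∧ t = replaceAt s p (e.2.subst θ)

def Irreducible {L : FirstOrder.Language.{u, v}} {V : Type w} (R : Set (L.Term V × L.Term V))
    (t : L.Term V) : Prop :=
  ∀ t', ¬ Rewrites R t t'

/-- `s` is a normal form of `t`. -/
def IsNormalForm {L : FirstOrder.Language.{u, v}} {V : Type w} (R : Set (L.Term V × L.Term V))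
    (s t : L.Term V) : Prop :=
  Relation.ReflTransGen (Rewrites R) t s ∧ Irreducible R s

/-- A substitution all of whose codomain terms are irreducible. -/
def SubstIrreducible {L : FirstOrder.Language.{u, v}} {V : Type w} (R : Set (L.Term V × L.Term V))
    (σ : Subst L V) : Prop :=
  ∀ x ∈ σ.dom, Irreducible R (σ x)

/-! ## Literals and clauses -/

/-- An equational literal `s ≈ t` (`pos = true`) or `s ≉ t` (`pos = false`). The two sides of an
equation are unordered. -/
@[ext]
structure Lit (L : FirstOrder.Language.{u, v}) (V : Type w) where
  pos : Bool
  eqn : Sym2 (L.Term V)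

def Lit.comp {L : FirstOrder.Language.{u, v}} {V : Type w} (K : Lit L V) : Lit L V := ⟨!K.pos, K.eqn⟩

def Lit.subst {L : FirstOrder.Language.{u, v}} {V : Type w} (K : Lit L V) (σ : Subst L V) : Lit L V :=
  ⟨K.pos, K.eqn.map (fun t => t.subst σ)⟩

def Lit.vars {L : FirstOrder.Language.{u, v}} {V : Type w} (K : Lit L V) : Set V :=
  {x | ∃ t ∈ K.eqn, x ∈ SCLEQ.vars t}

def Lit.Ground {L : FirstOrder.Language.{u, v}} {V : Type w} (K : Lit L V) : Prop := K.vars = ∅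

/-- The multiset `{s,t}` for `s ≈ t` and `{s,s,t,t}` for `s ≉ t`. -/
def Lit.termMultiset {L : FirstOrder.Language.{u, v}} {V : Type w} (K : Lit L V) : Multiset (L.Term V) :=
  if K.pos then K.eqn.toMultiset else K.eqn.toMultiset + K.eqn.toMultiset

abbrev Clause (L : FirstOrder.Language.{u, v}) (V : Type w) := Multiset (Lit L V)

def Clause.subst {L : FirstOrder.Language.{u, v}} {V : Type w} (C : Clause L V) (σ : Subst L V) :
    Clause L V :=
  Multiset.map (fun K => K.subst σ) C

def Clause.vars {L : FirstOrder.Language.{u, v}} {V : Type w} (C : Clause L V) : Set V :=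
  {x | ∃ K ∈ C, x ∈ Lit.vars K}

def Clause.Ground {L : FirstOrder.Language.{u, v}} {V : Type w} (C : Clause L V) : Prop :=
  ∀ K ∈ C, Lit.Ground K

/-- `σ` (with finite domain) is grounding for `C`. -/
def Grounding {L : FirstOrder.Language.{u, v}} {V : Type w} (σ : Subst L V) (C : Clause L V) : Prop :=
  σ.dom.Finite ∧ Clause.Ground (Clause.subst C σ)

/-- `≺_T` on literals. -/
def LitLt {L : FirstOrder.Language.{u, v}} {V : Type w} (lt : L.Term V → L.Term V → Prop)
    (K H : Lit L V) : Prop :=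
  MulExt lt K.termMultiset H.termMultiset

/-- `K ≺_T β` for a literal `K` and a term `β`. -/
def LitLtTerm {L : FirstOrder.Language.{u, v}} {V : Type w} (lt : L.Term V → L.Term V → Prop)
    (K : Lit L V) (β : L.Term V) : Prop :=
  MulExt lt K.termMultiset {β}

/-- `β ≺_T K` for a literal `K` and a term `β`. -/
def TermLtLit {L : FirstOrder.Language.{u, v}} {V : Type w} (lt : L.Term V → L.Term V → Prop)
    (β : L.Term V) (K : Lit L V) : Prop :=
  MulExt lt {β} K.termMultiset

/-- `C ≺_T β` for a clause `C` and a term `β`. -/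
def ClauseLtTerm {L : FirstOrder.Language.{u, v}} {V : Type w} (lt : L.Term V → L.Term V → Prop)
    (C : Clause L V) (β : L.Term V) : Prop :=
  MulExt (MulExt lt) (Multiset.map Lit.termMultiset C) {{β}}

/-! ## Semantics -/

def Lit.Holds {L : FirstOrder.Language.{u, v}} {V : Type w} {M : Type*} [L.Structure M] (a : V → M)
    (K : Lit L V) : Prop :=
  if K.pos then (K.eqn.map (fun t => t.realize a)).IsDiag
  else ¬ (K.eqn.map (fun t => t.realize a)).IsDiag

/-- Semantic entailment `G ⊨ K` for a set of (ground) literals `G`. -/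
def Entails {L : FirstOrder.Language.{u, v}} {V : Type w} (G : Set (Lit L V)) (K : Lit L V) : Prop :=
  ∀ (M : Type (max u w)) [L.Structure M] [Nonempty M] (a : V → M),
    (∀ H ∈ G, Lit.Holds a H) → Lit.Holds a K

/-- `K` is true or false in `G`. -/
def Defined {L : FirstOrder.Language.{u, v}} {V : Type w} (G : Set (Lit L V)) (K : Lit L V) : Prop :=
  Entails G K ∨ Entails G K.comp

/-! ## Trails -/

/-- A closure `(K ∨ C)·σ` with a distinguished literal `K`. -/
structure Closure (L : FirstOrder.Language.{u, v}) (V : Type w) where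
  lit : Lit L V
  rest : Clause L V
  sub : Subst L V

def Closure.clause {L : FirstOrder.Language.{u, v}} {V : Type w} (c : Closure L V) : Clause L V :=
  c.lit ::ₘ c.rest

/-- The ground literal of a closure. -/
def Closure.glit {L : FirstOrder.Language.{u, v}} {V : Type w} (c : Closure L V) : Lit L V :=
  c.lit.subst c.sub

def Closure.vars {L : FirstOrder.Language.{u, v}} {V : Type w} (c : Closure L V) : Set V :=
  Clause.vars c.clause

/-- An annotated literal `Kσ^{i:(K ∨ C)·σ}`. -/
structure AnnLit (L : FirstOrder.Language.{u, v}) (V : Type w) where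
  closure : Closure L V
  level : ℕ

def AnnLit.glit {L : FirstOrder.Language.{u, v}} {V : Type w} (a : AnnLit L V) : Lit L V := a.closure.glit

/-- A sequence of annotated ground literals, in chronological order. -/
abbrev Trail (L : FirstOrder.Language.{u, v}) (V : Type w) := List (AnnLit L V)

/-- The set of ground literals of a trail. -/
def Trail.lits {L : FirstOrder.Language.{u, v}} {V : Type w} (Γ : Trail L V) : Set (Lit L V) :=
  {K | ∃ a ∈ Γ, AnnLit.glit a = K}

/-- The convergent rewrite system `conv(G)` of the positive equations in `G`: all ground rules
`l → r` with `r ≺_T l` such that `l ≈ r` follows from these equations. All rules are oriented by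
`≺_T`, and the normal form of a ground term is the `≺_T`-least ground term equal to it modulo
the equations; so normal forms (and irreducibility) of ground terms are those of any convergent
system oriented by `≺_T` that presents the same equations. -/
def conv {L : FirstOrder.Language.{u, v}} {V : Type w} (lt : L.Term V → L.Term V → Prop)
    (G : Set (Lit L V)) : Set (L.Term V × L.Term V) :=
  {e | vars e.1 = ∅ ∧ vars e.2 = ∅ ∧ lt e.2 e.1 ∧
    Entails {K | K ∈ G ∧ K.pos = true} ⟨true, s(e.1, e.2)⟩}

def BTrue {L : FirstOrder.Language.{u, v}} {V : Type w} (lt : L.Term V → L.Term V → Prop)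
    (Γ : Trail L V) (β : L.Term V) (K : Lit L V) : Prop :=
  LitLtTerm lt K β ∧ Entails (Trail.lits Γ) K

def BFalse {L : FirstOrder.Language.{u, v}} {V : Type w} (lt : L.Term V → L.Term V → Prop)
    (Γ : Trail L V) (β : L.Term V) (K : Lit L V) : Prop :=
  LitLtTerm lt K β ∧ Entails (Trail.lits Γ) K.comp

def BUndef {L : FirstOrder.Language.{u, v}} {V : Type w} (lt : L.Term V → L.Term V → Prop)
    (Γ : Trail L V) (β : L.Term V) (K : Lit L V) : Prop :=
  TermLtLit lt β K ∨ ¬ Defined (Trail.lits Γ) K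

def BDef {L : FirstOrder.Language.{u, v}} {V : Type w} (lt : L.Term V → L.Term V → Prop)
    (Γ : Trail L V) (β : L.Term V) (K : Lit L V) : Prop :=
  LitLtTerm lt K β ∧ Defined (Trail.lits Γ) K

def ClauseBTrue {L : FirstOrder.Language.{u, v}} {V : Type w} (lt : L.Term V → L.Term V → Prop)
    (Γ : Trail L V) (β : L.Term V) (C : Clause L V) : Prop :=
  ∃ K ∈ C, BTrue lt Γ β K

def ClauseBFalse {L : FirstOrder.Language.{u, v}} {V : Type w} (lt : L.Term V → L.Term V → Prop)
    (Γ : Trail L V) (β : L.Term V) (C : Clause L V) : Prop :=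
  ∀ K ∈ C, BFalse lt Γ β K

def ClauseBUndef {L : FirstOrder.Language.{u, v}} {V : Type w} (lt : L.Term V → L.Term V → Prop)
    (Γ : Trail L V) (β : L.Term V) (C : Clause L V) : Prop :=
  ¬ ClauseBTrue lt Γ β C ∧ ¬ ClauseBFalse lt Γ β C

/-! ## Cores, defining literals, levels -/

/-- The literals of the subsequence of `Γ` with index set `Δ`. -/
def subLits {L : FirstOrder.Language.{u, v}} {V : Type w} (Γ : Trail L V) (Δ : Finset (Fin Γ.length)) :
    Set (Lit L V) :=
  {K | ∃ i ∈ Δ, (Γ.get i).glit = K}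

/-- A core of `K`: a minimal subsequence of `Γ` in which `K` is defined. -/
def IsCore {L : FirstOrder.Language.{u, v}} {V : Type w} (Γ : Trail L V) (K : Lit L V)
    (Δ : Finset (Fin Γ.length)) : Prop :=
  Minimal (fun Δ => Defined (subLits Γ Δ) K) Δ

/-- The `i`-th literal of `Γ` is the defining literal of `K`: it is the maximum of a core whose
maximum is smallest among all cores. -/
def IsDefining {L : FirstOrder.Language.{u, v}} {V : Type w} (Γ : Trail L V) (K : Lit L V)
    (i : Fin Γ.length) : Prop :=
  (∃ Δ, IsCore Γ K Δ ∧ IsGreatest (Δ : Set (Fin Γ.length)) i) ∧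
  ∀ Λ, IsCore Γ K Λ → ∃ j, IsGreatest (Λ : Set (Fin Γ.length)) j ∧ i ≤ j

/-- The ground literal `K` is of level `n` in `Γ`. -/
def HasLevel {L : FirstOrder.Language.{u, v}} {V : Type w} (Γ : Trail L V) (K : Lit L V) (n : ℕ) : Prop :=
  (∃ a ∈ Γ, AnnLit.glit a = K ∧ a.level = n) ∨
  (K ∉ Trail.lits Γ ∧ Defined (Trail.lits Γ) K ∧
    ((∃ i, IsDefining Γ K i ∧ (Γ.get i).level = n) ∨ ((¬ ∃ i, IsDefining Γ K i) ∧ n = 0)))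

/-- The ground clause `C` is of level `n` in `Γ`: `n` is the maximum of the levels of its
literals (`0` for the empty clause). -/
def ClauseHasLevel {L : FirstOrder.Language.{u, v}} {V : Type w} (Γ : Trail L V) (C : Clause L V)
    (n : ℕ) : Prop :=
  (∀ K ∈ C, ∃ m ≤ n, HasLevel Γ K m) ∧ ((C = 0 ∧ n = 0) ∨ ∃ K ∈ C, HasLevel Γ K n)

/-- The level of the last literal, `0` for the empty trail. -/
def Trail.lastLevel {L : FirstOrder.Language.{u, v}} {V : Type w} (Γ : Trail L V) : ℕ :=
  (Γ.getLast?.map AnnLit.level).getD 0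

/-! ## The trail induced ordering -/

/-- `β`-defined and of level greater than zero. -/
def Pos {L : FirstOrder.Language.{u, v}} {V : Type w} (lt : L.Term V → L.Term V → Prop)
    (Γ : Trail L V) (β : L.Term V) (K : Lit L V) : Prop :=
  BDef lt Γ β K ∧ ∃ n, 0 < n ∧ HasLevel Γ K n

/-- `β`-defined and of level zero. -/
def Zero {L : FirstOrder.Language.{u, v}} {V : Type w} (lt : L.Term V → L.Term V → Prop)
    (Γ : Trail L V) (β : L.Term V) (K : Lit L V) : Prop :=
  BDef lt Γ β K ∧ HasLevel Γ K 0

/-- `K` is one of the `β`-defined literals `M_{i,_}`: neither `K` nor its complement is on the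
trail, and the `i`-th trail literal is its defining literal. -/
def IsM {L : FirstOrder.Language.{u, v}} {V : Type w} (lt : L.Term V → L.Term V → Prop)
    (Γ : Trail L V) (β : L.Term V) (i : Fin Γ.length) (K : Lit L V) : Prop :=
  BDef lt Γ β K ∧ K ∉ Trail.lits Γ ∧ K.comp ∉ Trail.lits Γ ∧ IsDefining Γ K i

/-- The clauses of the trail induced ordering; `K.comp = L_i` expresses `K = comp(L_i)`, and
the literals `M_{i,j}` with the same defining literal `L_i` are enumerated along `≺_T`. -/
inductive TrailRel {L : FirstOrder.Language.{u, v}} {V : Type w} (lt : L.Term V → L.Term V → Prop)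
    (Γ : Trail L V) (β : L.Term V) : Lit L V → Lit L V → Prop
  | mm (K H : Lit L V) (i j : Fin Γ.length) : Pos lt Γ β K → Pos lt Γ β H →
      IsM lt Γ β i K → IsM lt Γ β j H → (i < j ∨ (i = j ∧ LitLt lt K H)) → TrailRel lt Γ β K H
  | ll (K H : Lit L V) (i j : Fin Γ.length) : Pos lt Γ β K → Pos lt Γ β H →
      K = (Γ.get i).glit → H = (Γ.get j).glit → i < j → TrailRel lt Γ β K H
  | cl (K H : Lit L V) (i j : Fin Γ.length) : Pos lt Γ β K → Pos lt Γ β H →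
      K.comp = (Γ.get i).glit → H = (Γ.get j).glit → i < j → TrailRel lt Γ β K H
  | lc (K H : Lit L V) (i j : Fin Γ.length) : Pos lt Γ β K → Pos lt Γ β H →
      K = (Γ.get i).glit → H.comp = (Γ.get j).glit → (i < j ∨ i = j) → TrailRel lt Γ β K H
  | cc (K H : Lit L V) (i j : Fin Γ.length) : Pos lt Γ β K → Pos lt Γ β H →
      K.comp = (Γ.get i).glit → H.comp = (Γ.get j).glit → i < j → TrailRel lt Γ β K H
  | lm (K H : Lit L V) (i k : Fin Γ.length) : Pos lt Γ β K → Pos lt Γ β H →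
      (K = (Γ.get i).glit ∨ K.comp = (Γ.get i).glit) → IsM lt Γ β k H → i ≤ k →
      TrailRel lt Γ β K H
  | ml (K H : Lit L V) (k i : Fin Γ.length) : Pos lt Γ β K → Pos lt Γ β H →
      IsM lt Γ β k K → (H = (Γ.get i).glit ∨ H.comp = (Γ.get i).glit) → k < i →
      TrailRel lt Γ β K H
  | zz (K H : Lit L V) : Zero lt Γ β K → Zero lt Γ β H → LitLt lt K H → TrailRel lt Γ β K H
  | zp (K H : Lit L V) : Zero lt Γ β K → Pos lt Γ β H → TrailRel lt Γ β K H
  | uu (K H : Lit L V) : BUndef lt Γ β K → BUndef lt Γ β H → LitLt lt K H → TrailRel lt Γ β K H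
  | du (K H : Lit L V) : BDef lt Γ β K → BUndef lt Γ β H → TrailRel lt Γ β K H

/-- The trail induced ordering `≺_{Γ*}` on ground literals. -/
def TrailLt {L : FirstOrder.Language.{u, v}} {V : Type w} (lt : L.Term V → L.Term V → Prop)
    (Γ : Trail L V) (β : L.Term V) (K H : Lit L V) : Prop :=
  K.Ground ∧ H.Ground ∧ TrailRel lt Γ β K H

/-- The trail induced ordering `≺_{Γ*}` on ground clauses. -/
def TrailClauseLt {L : FirstOrder.Language.{u, v}} {V : Type w} (lt : L.Term V → L.Term V → Prop)
    (Γ : Trail L V) (β : L.Term V) (C D : Clause L V) : Prop :=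
  MulExt (TrailLt lt Γ β) C D

/-! ## Rewrite steps, reduction chains, refutations -/

/-- Rewrite steps `(K·σ, (K ∨ C)·σ, R, S, p)`; in `leaf` the last three entries are empty. -/
inductive RStep (L : FirstOrder.Language.{u, v}) (V : Type w) : Type (max u w)
  | leaf (c : Closure L V) : RStep L V
  | node (c : Closure L V) (R S : RStep L V) (p : List ℕ) : RStep L V

def RStep.closure {L : FirstOrder.Language.{u, v}} {V : Type w} : RStep L V → Closure L V
  | .leaf c => c
  | .node c _ _ _ => c

/-- `c'` is a variant of `c`: its clause is renamed, and its substitution has the same ground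
instance and acts on the variables of its clause only. -/
def IsVariant {L : FirstOrder.Language.{u, v}} {V : Type w} (c c' : Closure L V) : Prop :=
  ∃ π : Equiv.Perm V,
    c'.lit = c.lit.subst (fun x => FirstOrder.Language.Term.var (π x)) ∧
    c'.rest = Clause.subst c.rest (fun x => FirstOrder.Language.Term.var (π x)) ∧
    (∀ x ∈ c.vars, c'.sub (π x) = c.sub x) ∧
    c'.sub.dom ⊆ c'.vars

/-- `I₃` is the result of a rewrite inference from `I₁` and `I₂`, which are made variable
disjoint by renaming. The first alternative rewrites at a position of the literal of `I₂`, the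
second one at a position below a variable of it: there `δ` gives the most general instance with
the position `p` that still has the ground literal of `I₂` as an instance, `δ` introduces only
fresh variables, and `ρ` instantiates just these. As literals are unordered, the rewritten side
may be called `l₂`. -/
def IsRewriteInference {L : FirstOrder.Language.{u, v}} {V : Type w} (lt : L.Term V → L.Term V → Prop)
    (I₁ I₂ I₃ : RStep L V) : Prop :=
  ∃ c₁ c₂ : Closure L V, IsVariant I₁.closure c₁ ∧ IsVariant I₂.closure c₂ ∧
    Disjoint c₁.vars c₂.vars ∧
  ∃ (l₁ r₁ l₂ r₂ : L.Term V) (b : Bool) (p : List ℕ),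
    c₁.lit = ⟨true, s(l₁, r₁)⟩ ∧ c₂.lit = ⟨b, s(l₂, r₂)⟩ ∧
    lt (r₁.subst c₁.sub) (l₁.subst c₁.sub) ∧
    subtermAt (l₂.subst c₂.sub) p = some (l₁.subst c₁.sub) ∧
    ((∃ (t : L.Term V) (μ : Subst L V), subtermAt l₂ p = some t ∧ IsMGU {(t, l₁)} μ ∧
        I₃ = RStep.node
          ⟨Lit.subst ⟨b, s(replaceAt l₂ p r₁, r₂)⟩ μ,
            Clause.subst c₁.rest μ + Clause.subst c₂.rest μ, c₁.sub.comp c₂.sub⟩ I₁ I₂ p) ∨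
     (subtermAt l₂ p = none ∧ ∃ (δ ρ μ : Subst L V) (t : L.Term V),
        δ.dom ⊆ vars l₂ ∪ vars r₂ ∧
        (∀ x ∈ δ.dom, Disjoint (vars (δ x)) (c₁.vars ∪ c₂.vars)) ∧
        subtermAt (l₂.subst δ) p = some t ∧
        ((l₂.subst δ).subst c₂.sub).subst ρ = l₂.subst c₂.sub ∧
        ((r₂.subst δ).subst c₂.sub).subst ρ = r₂.subst c₂.sub ∧
        ρ.dom ⊆ (vars (l₂.subst δ) ∪ vars (r₂.subst δ)) \ (c₁.vars ∪ c₂.vars) ∧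
        (∀ θ : Subst L V, subtermAt (l₂.subst θ) p ≠ none →
          (∃ τ : Subst L V, (l₂.subst θ).subst τ = l₂.subst c₂.sub ∧
            (r₂.subst θ).subst τ = r₂.subst c₂.sub) →
          ∃ τ : Subst L V, l₂.subst θ = (l₂.subst δ).subst τ ∧
            r₂.subst θ = (r₂.subst δ).subst τ) ∧
        IsMGU {(t, l₁)} μ ∧
        I₃ = RStep.node
          ⟨Lit.subst ⟨b, s(replaceAt (l₂.subst δ) p r₁, r₂.subst δ)⟩ μ,
            Clause.subst c₁.rest μ + Clause.subst (Clause.subst c₂.rest δ) μ,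
            (c₁.sub.comp c₂.sub).comp ρ⟩ I₁ I₂ p))

/-- A reduction chain from the closures in `S`. -/
def IsChain {L : FirstOrder.Language.{u, v}} {V : Type w} (lt : L.Term V → L.Term V → Prop)
    (S : Set (Closure L V)) (P : List (RStep L V)) : Prop :=
  ∀ i : Fin P.length, (∃ c ∈ S, P.get i = RStep.leaf c) ∨
    ∃ j k : Fin P.length, j < i ∧ k < i ∧ IsRewriteInference lt (P.get j) (P.get k) (P.get i)

/-- The closures annotating the literals of `Γ`, together with `c`. -/
def leafSet {L : FirstOrder.Language.{u, v}} {V : Type w} (Γ : Trail L V) (c : Closure L V) :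
    Set (Closure L V) :=
  {d | d = c ∨ ∃ a ∈ Γ, AnnLit.closure a = d}

/-- `K'` is the normal form of the literal `K`. -/
def IsLitNormalForm {L : FirstOrder.Language.{u, v}} {V : Type w} (R : Set (L.Term V × L.Term V))
    (K' K : Lit L V) : Prop :=
  ∃ (b : Bool) (s t s' t' : L.Term V), K = ⟨b, s(s, t)⟩ ∧ K' = ⟨b, s(s', t')⟩ ∧
    IsNormalForm R s' s ∧ IsNormalForm R t' t

/-- Reduction chain application, before minimality is imposed. -/
def ReducesTo {L : FirstOrder.Language.{u, v}} {V : Type w} (lt : L.Term V → L.Term V → Prop)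
    (Γ : Trail L V) (c : Closure L V) (P : List (RStep L V)) : Prop :=
  IsChain lt (leafSet Γ c) P ∧ ∃ I, P.getLast? = some I ∧
    IsLitNormalForm (conv lt (Trail.lits Γ)) I.closure.glit c.glit

/-- `P` is a (minimal) reduction chain application from `Γ` to the literal of `c`. -/
def IsReductionChainApp {L : FirstOrder.Language.{u, v}} {V : Type w} (lt : L.Term V → L.Term V → Prop)
    (Γ : Trail L V) (c : Closure L V) (P : List (RStep L V)) : Prop :=
  ReducesTo lt Γ c P ∧ ∀ i < P.length, ¬ ReducesTo lt Γ c (P.eraseIdx i)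

/-- Refutation, before minimality is imposed. -/
def Refutes {L : FirstOrder.Language.{u, v}} {V : Type w} (lt : L.Term V → L.Term V → Prop)
    (Γ : Trail L V) (c : Closure L V) (P : List (RStep L V)) : Prop :=
  IsChain lt (leafSet Γ c) P ∧ ∃ I, P.getLast? = some I ∧
    ∃ s : L.Term V, I.closure.glit = ⟨false, s(s, s)⟩

/-- `P` is a (minimal) refutation from `Γ` and the `β`-false literal of `c`. -/
def IsRefutation {L : FirstOrder.Language.{u, v}} {V : Type w} (lt : L.Term V → L.Term V → Prop)
    (Γ : Trail L V) (β : L.Term V) (c : Closure L V) (P : List (RStep L V)) : Prop :=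
  BFalse lt Γ β c.glit ∧ Refutes lt Γ c P ∧
    ∀ i, i + 1 < P.length → ¬ Refutes lt Γ c (P.eraseIdx i)

/-! ## The calculus -/

/-- The status of a state: `⊤`, `⊥` or a closure `D·σ`. -/
inductive Status (L : FirstOrder.Language.{u, v}) (V : Type w) : Type (max u w)
  | top : Status L V
  | bot : Status L V
  | confl (D : Clause L V) (σ : Subst L V) : Status L V

/-- A state `(Γ; N; U; β; k; D)`. -/
structure State (L : FirstOrder.Language.{u, v}) (V : Type w) where
  trail : Trail L V
  N : Set (Clause L V)
  U : Set (Clause L V)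
  β : L.Term V
  k : ℕ
  status : Status L V

inductive Rule
  | propagate | decide | conflict | skip | explore | factorize | eqRes | backtrack | grow

/-- Some ground instance of `C` is `β`-false in `Γ, K` but not in `Γ`. -/
def BecomesFalse {L : FirstOrder.Language.{u, v}} {V : Type w} (lt : L.Term V → L.Term V → Prop)
    (Γ : Trail L V) (K : AnnLit L V) (β : L.Term V) (C : Clause L V) : Prop :=
  ∃ τ : Subst L V, Grounding τ C ∧ ClauseBFalse lt (Γ ++ [K]) β (Clause.subst C τ) ∧
    ¬ ClauseBFalse lt Γ β (Clause.subst C τ)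

/-- The inference rules. -/
inductive Step {L : FirstOrder.Language.{u, v}} {V : Type w} (lt : L.Term V → L.Term V → Prop) :
    Rule → State L V → State L V → Prop
  | propagate (Γ : Trail L V) (N U : Set (Clause L V)) (β : L.Term V) (k : ℕ)
      (C₀ : Clause L V) (C₁ : Multiset (L.Term V × L.Term V)) (b : Bool) (s t : L.Term V)
      (σ μ : Subst L V) (P : List (RStep L V)) (I : RStep L V) :
      -- the clause is `C₀ ∨ C₁ ∨ (s # t)`, where `C₁` consists of the literals `e.1 # e.2`
      ((⟨b, s(s, t)⟩ : Lit L V) ::ₘ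
        (C₀ + C₁.map (fun e => (⟨b, s(e.1, e.2)⟩ : Lit L V)))) ∈ N ∪ U →
      Grounding σ ((⟨b, s(s, t)⟩ : Lit L V) ::ₘ
        (C₀ + C₁.map (fun e => (⟨b, s(e.1, e.2)⟩ : Lit L V)))) →
      (∀ K ∈ Clause.subst C₀ σ, Entails (Trail.lits Γ) (Lit.comp K)) →
      (∀ e ∈ C₁, e.1.subst σ = s.subst σ ∧ e.2.subst σ = t.subst σ) →
      IsMGU {d | ∃ e ∈ C₁, d = (e.1, s) ∨ d = (e.2, t)} μ →
      BUndef lt Γ β (Lit.subst ⟨b, s(s, t)⟩ σ) →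
      ClauseLtTerm lt
        (Clause.subst (Clause.subst ((⟨b, s(s, t)⟩ : Lit L V) ::ₘ C₀) μ) σ) β →
      SubstIrreducible (conv lt (Trail.lits Γ)) σ →
      IsReductionChainApp lt Γ ⟨Lit.subst ⟨b, s(s, t)⟩ μ, Clause.subst C₀ μ, σ⟩ P →
      P.getLast? = some I →
      Step lt Rule.propagate ⟨Γ, N, U, β, k, Status.top⟩
        ⟨Γ ++ [⟨I.closure, k⟩], N, U, β, k, Status.top⟩
  | decide (Γ : Trail L V) (N U : Set (Clause L V)) (β : L.Term V) (k : ℕ)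
      (C₀ : Clause L V) (K : Lit L V) (σ : Subst L V) (P : List (RStep L V)) (I : RStep L V) :
      (K ::ₘ C₀) ∈ N ∪ U →
      Grounding σ (K ::ₘ C₀) →
      (ClauseBUndef lt Γ β (Clause.subst C₀ σ) ∨ ClauseBTrue lt Γ β (Clause.subst C₀ σ)) →
      BUndef lt Γ β (K.subst σ) →
      ClauseLtTerm lt (Clause.subst (K ::ₘ C₀) σ) β →
      SubstIrreducible (conv lt (Trail.lits Γ)) σ →
      IsReductionChainApp lt Γ ⟨K, C₀, σ⟩ P →
      P.getLast? = some I →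
      Step lt Rule.decide ⟨Γ, N, U, β, k, Status.top⟩
        ⟨Γ ++ [⟨⟨I.closure.lit, {I.closure.lit.comp}, I.closure.sub⟩, k + 1⟩], N, U, β, k + 1,
          Status.top⟩
  | conflictBot (Γ : Trail L V) (N U : Set (Clause L V)) (β : L.Term V) (k : ℕ)
      (D : Clause L V) (σ : Subst L V) :
      D ∈ N ∪ U → Grounding σ D → ClauseBFalse lt Γ β (Clause.subst D σ) →
      SubstIrreducible (conv lt (Trail.lits Γ)) σ →
      ClauseHasLevel Γ (Clause.subst D σ) 0 →
      Step lt Rule.conflict ⟨Γ, N, U, β, k, Status.top⟩ ⟨Γ, N, U, β, k, Status.bot⟩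
  | conflict (Γ : Trail L V) (N U : Set (Clause L V)) (β : L.Term V) (k : ℕ)
      (D : Clause L V) (σ : Subst L V) :
      D ∈ N ∪ U → Grounding σ D → ClauseBFalse lt Γ β (Clause.subst D σ) →
      SubstIrreducible (conv lt (Trail.lits Γ)) σ →
      ¬ ClauseHasLevel Γ (Clause.subst D σ) 0 →
      Step lt Rule.conflict ⟨Γ, N, U, β, k, Status.top⟩ ⟨Γ, N, U, β, k, Status.confl D σ⟩
  | skip (Γ : Trail L V) (K H : AnnLit L V) (N U : Set (Clause L V)) (β : L.Term V) (k : ℕ)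
      (D : Clause L V) (σ : Subst L V) :
      H.level = k →
      ClauseBFalse lt (Γ ++ [K]) β (Clause.subst D σ) →
      Step lt Rule.skip ⟨Γ ++ [K, H], N, U, β, k, Status.confl D σ⟩
        ⟨Γ ++ [K], N, U, β, K.level, Status.confl D σ⟩
  | explore (Γ : Trail L V) (N U : Set (Clause L V)) (β : L.Term V) (k : ℕ)
      (D : Clause L V) (K : Lit L V) (σ : Subst L V) (i : Fin Γ.length)
      (P : List (RStep L V)) (I : RStep L V) :
      (∀ H ∈ Clause.subst D σ, TrailLt lt Γ β H (K.subst σ)) →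
      -- the last trail literal is the defining literal
      i.val + 1 = Γ.length → IsDefining Γ (K.subst σ) i →
      IsRefutation lt Γ β ⟨K, D, σ⟩ P →
      I ∈ P →
      TrailClauseLt lt Γ β (Clause.subst I.closure.clause I.closure.sub)
        (Clause.subst (K ::ₘ D) σ) →
      ClauseBFalse lt Γ β (Clause.subst I.closure.clause I.closure.sub) →
      Step lt Rule.explore ⟨Γ, N, U, β, k, Status.confl (K ::ₘ D) σ⟩
        ⟨Γ, N, U, β, k, Status.confl I.closure.clause I.closure.sub⟩
  | factorize (Γ : Trail L V) (N U : Set (Clause L V)) (β : L.Term V) (k : ℕ)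
      (D : Clause L V) (b : Bool) (s t s' t' : L.Term V) (σ μ : Subst L V) :
      s.subst σ = s'.subst σ → t.subst σ = t'.subst σ →
      IsMGU {(s, s'), (t, t')} μ →
      Step lt Rule.factorize
        ⟨Γ, N, U, β, k,
          Status.confl ((⟨b, s(s, t)⟩ : Lit L V) ::ₘ (⟨b, s(s', t')⟩ : Lit L V) ::ₘ D) σ⟩
        ⟨Γ, N, U, β, k,
          Status.confl (Clause.subst ((⟨b, s(s, t)⟩ : Lit L V) ::ₘ D) μ) σ⟩
  | eqRes (Γ : Trail L V) (N U : Set (Clause L V)) (β : L.Term V) (k : ℕ)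
      (D : Clause L V) (s s' : L.Term V) (σ μ : Subst L V) :
      s.subst σ = s'.subst σ → IsMGU {(s, s')} μ →
      Step lt Rule.eqRes
        ⟨Γ, N, U, β, k, Status.confl ((⟨false, s(s, s')⟩ : Lit L V) ::ₘ D) σ⟩
        ⟨Γ, N, U, β, k, Status.confl (Clause.subst D μ) σ⟩
  | backtrack (Γ Γ' : Trail L V) (K : AnnLit L V) (N U : Set (Clause L V)) (β : L.Term V)
      (k i i' : ℕ) (D : Clause L V) (H : Lit L V) (σ : Subst L V) :
      ClauseHasLevel (Γ ++ K :: Γ') (Clause.subst D σ) i' → i' < k →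
      BecomesFalse lt Γ K β (H ::ₘ D) →
      (∀ (Γ₁ Γ₂ : Trail L V) (K₁ : AnnLit L V), Γ ++ K :: Γ' = Γ₁ ++ K₁ :: Γ₂ →
        Γ₁.length < Γ.length → ¬ BecomesFalse lt Γ₁ K₁ β (H ::ₘ D)) →
      -- `i = 1` if `K` is a decision literal, `i = 0` otherwise
      (K.level = Trail.lastLevel Γ + 1 → i = 1) →
      (K.level ≠ Trail.lastLevel Γ + 1 → i = 0) →
      Step lt Rule.backtrack ⟨Γ ++ K :: Γ', N, U, β, k, Status.confl (H ::ₘ D) σ⟩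
        ⟨Γ, N, U ∪ {H ::ₘ D}, β, K.level - i, Status.top⟩
  | grow (Γ : Trail L V) (N U : Set (Clause L V)) (β β' : L.Term V) (k : ℕ) :
      vars β' = ∅ → lt β β' →
      Step lt Rule.grow ⟨Γ, N, U, β, k, Status.top⟩ ⟨[], N, U, β', 0, Status.top⟩

/-- A run of length `n`: `st i` is the `i`-th state and `rl i` the rule that is applied in it. -/
structure IsRun {L : FirstOrder.Language.{u, v}} {V : Type w} (lt : L.Term V → L.Term V → Prop)
    (n : ℕ) (st : ℕ → State L V) (rl : ℕ → Rule) : Prop where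
  init : ∃ (N : Set (Clause L V)) (β : L.Term V), vars β = ∅ ∧
    st 0 = ⟨[], N, ∅, β, 0, Status.top⟩
  step : ∀ i < n, Step lt (rl i) (st i) (st (i + 1))

/-- The rule `ρ` is applicable in the state `S`. -/
def Applicable {L : FirstOrder.Language.{u, v}} {V : Type w} (lt : L.Term V → L.Term V → Prop)
    (ρ : Rule) (S : State L V) : Prop :=
  ∃ S', Step lt ρ S S'

/-- The application of Conflict at step `m` starts the conflict resolution that is finished by
the application of Backtrack at step `j`. -/
def Resolves (rl : ℕ → Rule) (m j : ℕ) : Prop :=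
  m < j ∧ rl m = Rule.conflict ∧ rl j = Rule.backtrack ∧
    ∀ i, m < i → i < j → rl i ≠ Rule.conflict ∧ rl i ≠ Rule.backtrack

/-- The application of Conflict at step `m` immediately follows an application of Decide. -/
def AfterDecide (rl : ℕ → Rule) (m : ℕ) : Prop :=
  ∃ i, m = i + 1 ∧ rl i = Rule.decide

/-- A regular run. -/
structure IsRegularRun {L : FirstOrder.Language.{u, v}} {V : Type w} (lt : L.Term V → L.Term V → Prop)
    (n : ℕ) (st : ℕ → State L V) (rl : ℕ → Rule) : Prop extends IsRun lt n st rl where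
  precedence : ∀ i < n, rl i ≠ Rule.conflict → rl i ≠ Rule.factorize →
    ¬ Applicable lt Rule.conflict (st i) ∧ ¬ Applicable lt Rule.factorize (st i)
  propagateFirst : ∀ i < n, (st i).k = 0 → rl i = Rule.decide →
    ¬ Applicable lt Rule.propagate (st i)
  noDecideComp : ∀ i < n, rl i = Rule.decide → ∀ (S' : State L V) (a a' : AnnLit L V),
    Step lt Rule.propagate (st i) S' → S'.trail = (st i).trail ++ [a] →
    a.closure.clause ∈ (st i).N ∪ (st i).U →
    (st (i + 1)).trail = (st i).trail ++ [a'] → a'.glit ≠ a.glit.comp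
  skipOnce : ∀ m j, j < n → Resolves rl m j →
    (∃ i, m < i ∧ i < j ∧ rl i = Rule.skip) ∨ AfterDecide rl m
  backtrackAfterDecide : ∀ m j, j < n → Resolves rl m j → AfterDecide rl m →
    ∃ (Γ : Trail L V) (a : AnnLit L V) (D : Clause L V) (σ : Subst L V) (K : Lit L V),
      (st j).trail = Γ ++ [a] ∧ (st j).status = Status.confl D σ ∧ K ∈ D ∧
      K.subst σ = a.glit.comp

/-- `S` is a state resulting from a regular run. -/
def ResultsFromRegularRun {L : FirstOrder.Language.{u, v}} {V : Type w}
    (lt : L.Term V → L.Term V → Prop) (S : State L V) : Prop :=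
  ∃ (n : ℕ) (st : ℕ → State L V) (rl : ℕ → Rule), IsRegularRun lt n st rl ∧ st n = S

end SCLEQ

namespace SCLEQ

open FirstOrder.Language (Term)
open Relation

universe u v w

variable {L : FirstOrder.Language.{u, v}} {V : Type w}

/-! ## Substitutions, variables and positions -/

/-! Replacing `lσ` by `rσ` in a literal gives an equivalent literal in every set that entails `lσ ≈
rσ`. The heart of the proof is that, in a regular run, the trail before any literal of positive
level already entails every ground instance of a unit equation of `N` that lies below `β`
(`UnitsEntailed`). Indeed, level 1 is only opened by a Decide at level 0, and regularity then
excludes Conflict and Propagate. Normalise the substitution of such an instance by `conv`: if the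
normalised instance were false, Conflict would apply, and if it were undefined, Propagate would
apply. So it is true, and with it the original instance (`unitsEntailed_of_not_applicable`). The
property is kept in an invariant over prefixes of the trail (`Appendable`, `Step.stateInv`).

Applicability of Propagate includes the existence of a reduction chain application, and this takes
up most of the work. The system `conv` contains all entailed decreasing ground rules, whereas a
chain may only use equations inferred from trail literals. Closing the positive trail equations
under ground superposition gives a confluent system with enough rules to reach the `conv`-normal
forms (`join_of_entails`, `irreducible_conv`), and each of its steps lifts to an inference between
closures (`exists_rewriteInference`, which needs the existence of mgus, `exists_isMGU`).

The comparison is then short (`trailLt_of_unit_rewrite`). Suppose the original literal becomes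
defined with the trail literal `L_i` of positive level. The equation is true before `L_i`, so the
rewritten literal becomes defined with `L_i` as well. Trail literals are irreducible with respect to
the prefix before them, whereas the original literal is reducible there; hence it is neither `L_i`
nor its complement, and it has index `i`. The rewritten literal is `L_i`, its complement, or a
`≺_T`-smaller literal of index `i`. If no such `L_i` exists, either both literals have level 0 and
`≺_T` decides, or the original literal is `β`-undefined and the comparison is immediate. -/

theorem subst_var (t : L.Term V) : t.subst Term.var = t := by
  induction t with
  | var x => rfl
  | func f ts ih => simp only [Term.subst, ih]

theorem subst_subst (t : L.Term V) (σ τ : Subst L V) :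
    (t.subst σ).subst τ = t.subst (σ.comp τ) := by
  induction t with
  | var x => rfl
  | func f ts ih => simp only [Term.subst, ih]

theorem subst_congr {t : L.Term V} {σ τ : Subst L V} (h : ∀ x ∈ vars t, σ x = τ x) :
    t.subst σ = t.subst τ := by
  induction t with
  | var x => exact h x (by simp [vars])
  | func f ts ih =>
    simp only [Term.subst]
    congr 1
    funext i
    exact ih i fun x hx => h x (by simp only [vars, Set.mem_iUnion]; exact ⟨i, hx⟩)

theorem eq_of_subst_eq {t : L.Term V} {σ τ : Subst L V} (h : t.subst σ = t.subst τ) :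
    ∀ x ∈ vars t, σ x = τ x := by
  induction t with
  | var x => intro y hy; simp only [vars, Set.mem_singleton_iff] at hy; subst hy; exact h
  | func f ts ih =>
    intro x hx
    simp only [vars, Set.mem_iUnion] at hx
    obtain ⟨i, hi⟩ := hx
    simp only [Term.subst, Term.func.injEq, heq_eq_eq, true_and] at h
    exact ih i (congrFun h i) x hi

theorem mem_vars_subst {t : L.Term V} {σ : Subst L V} {y : V} :
    y ∈ vars (t.subst σ) ↔ ∃ x ∈ vars t, y ∈ vars (σ x) := by
  induction t with
  | var x => simp [vars, Term.subst]
  | func f ts ih =>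
    simp only [vars, Term.subst, Set.mem_iUnion, ih]
    constructor
    · rintro ⟨i, x, hx, hy⟩; exact ⟨x, ⟨i, hx⟩, hy⟩
    · rintro ⟨x, ⟨i, hx⟩, hy⟩; exact ⟨i, x, hx, hy⟩

theorem vars_subst_eq_empty {t : L.Term V} {σ : Subst L V} :
    vars (t.subst σ) = ∅ ↔ ∀ x ∈ vars t, vars (σ x) = ∅ := by
  simp only [Set.eq_empty_iff_forall_notMem, mem_vars_subst]
  constructor
  · intro h x hx y hy; exact h y ⟨x, hx, hy⟩
  · rintro h y ⟨x, hx, hy⟩; exact h x hx y hy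

theorem subst_eq_self {t : L.Term V} {σ : Subst L V} (h : ∀ x ∈ vars t, σ x = Term.var x) :
    t.subst σ = t :=
  (subst_congr h).trans (subst_var t)

theorem subst_of_ground {t : L.Term V} (h : vars t = ∅) (σ : Subst L V) : t.subst σ = t :=
  subst_eq_self fun x hx => by simp [h] at hx

theorem finite_vars (t : L.Term V) : (vars t).Finite := by
  induction t with
  | var x => simp [vars]
  | func f ts ih => exact Set.finite_iUnion ih

theorem subtermAt_func {n : ℕ} (f : L.Functions n) (ts : Fin n → L.Term V) (i : Fin n)
    (p : List ℕ) : subtermAt (Term.func f ts) (i.val :: p) = subtermAt (ts i) p := by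
  simp [subtermAt]

theorem exists_of_subtermAt_cons {u s : L.Term V} {i : ℕ} {p : List ℕ}
    (h : subtermAt u (i :: p) = some s) :
    ∃ (n : ℕ) (f : L.Functions n) (ts : Fin n → L.Term V) (j : Fin n),
      u = Term.func f ts ∧ i = j.val ∧ subtermAt (ts j) p = some s := by
  cases u with
  | var x => simp [subtermAt] at h
  | @func n f ts =>
    simp only [subtermAt] at h
    split_ifs at h with hi
    exact ⟨n, f, ts, ⟨i, hi⟩, rfl, rfl, h⟩

theorem subtermAt_nil (u : L.Term V) : subtermAt u [] = some u := by
  cases u <;> rfl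

theorem replaceAt_nil (u s : L.Term V) : replaceAt u [] s = s := by
  cases u <;> rfl

theorem replaceAt_func {n : ℕ} (f : L.Functions n) (ts : Fin n → L.Term V) (i : Fin n)
    (p : List ℕ) (s : L.Term V) [DecidableEq (Fin n)] :
    replaceAt (Term.func f ts) (i.val :: p) s =
      Term.func f (Function.update ts i (replaceAt (ts i) p s)) := by
  simp only [replaceAt]
  congr 1
  funext j
  by_cases h : j = i
  · subst h; simp
  · simp [Fin.val_inj, h]

theorem subtermAt_subst {u s : L.Term V} {p : List ℕ} (h : subtermAt u p = some s)
    (σ : Subst L V) : subtermAt (u.subst σ) p = some (s.subst σ) := by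
  induction p generalizing u with
  | nil =>
    rw [subtermAt_nil] at h ⊢
    rw [Option.some.inj h]
  | cons i p ih =>
    obtain ⟨n, f, ts, j, rfl, rfl, h'⟩ := exists_of_subtermAt_cons h
    rw [Term.subst, subtermAt_func]
    exact ih h'

theorem replaceAt_subst {u : L.Term V} {p : List ℕ} (h : subtermAt u p ≠ none) (s : L.Term V)
    (σ : Subst L V) : (replaceAt u p s).subst σ = replaceAt (u.subst σ) p (s.subst σ) := by
  induction p generalizing u with
  | nil => simp only [replaceAt_nil]
  | cons i p ih =>
    obtain ⟨t, ht⟩ := Option.ne_none_iff_exists'.mp h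
    obtain ⟨n, f, ts, j, rfl, rfl, h'⟩ := exists_of_subtermAt_cons ht
    simp only [replaceAt, Term.subst]
    congr 1
    funext k
    by_cases hk : k.val = j.val
    · obtain rfl := Fin.ext hk
      simpa using ih (by simp [h'])
    · simp [hk]

theorem vars_subtermAt {u s : L.Term V} {p : List ℕ} (h : subtermAt u p = some s) :
    vars s ⊆ vars u := by
  induction p generalizing u with
  | nil =>
    rw [subtermAt_nil] at h
    rw [Option.some.inj h]
  | cons i p ih =>
    obtain ⟨n, f, ts, j, rfl, rfl, h'⟩ := exists_of_subtermAt_cons h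
    exact (ih h').trans fun x hx => by simp only [vars, Set.mem_iUnion]; exact ⟨j, hx⟩

theorem vars_replaceAt (u : L.Term V) (p : List ℕ) (s : L.Term V) :
    vars (replaceAt u p s) ⊆ vars u ∪ vars s := by
  induction p generalizing u with
  | nil => rw [replaceAt_nil]; exact Set.subset_union_right
  | cons i p ih =>
    cases u with
    | var x => exact Set.subset_union_left
    | func f ts =>
      simp only [replaceAt, vars]
      refine Set.iUnion_subset fun j => ?_
      split_ifs
      · refine (ih (ts j)).trans (Set.union_subset_union_left _ ?_)
        exact Set.subset_iUnion (fun j => vars (ts j)) j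
      · exact (Set.subset_iUnion (fun j => vars (ts j)) j).trans Set.subset_union_left

theorem vars_replaceAt_eq_empty {u s : L.Term V} (hu : vars u = ∅) (hs : vars s = ∅)
    (p : List ℕ) : vars (replaceAt u p s) = ∅ := by
  have := vars_replaceAt u p s
  rwa [hu, hs, Set.union_self, Set.subset_empty_iff] at this

theorem replaceAt_self {u s : L.Term V} {p : List ℕ} (h : subtermAt u p = some s) :
    replaceAt u p s = u := by
  induction p generalizing u with
  | nil =>
    rw [subtermAt_nil] at h
    rw [replaceAt_nil, Option.some.inj h]
  | cons i p ih =>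
    obtain ⟨n, f, ts, j, rfl, rfl, h'⟩ := exists_of_subtermAt_cons h
    rw [replaceAt_func, ih h', Function.update_eq_self]

theorem subtermAt_append (u : L.Term V) (p q : List ℕ) :
    subtermAt u (p ++ q) = (subtermAt u p).bind fun s => subtermAt s q := by
  induction p generalizing u with
  | nil => simp [subtermAt_nil]
  | cons i p ih =>
    cases u with
    | var x => rfl
    | func f ts =>
      simp only [List.cons_append, subtermAt]
      split_ifs
      · exact ih _
      · rfl

/-- A position of an instance is a position of the term or lies below one of its variables. -/
theorem exists_var_of_subtermAt_subst {u : L.Term V} {σ : Subst L V} {p : List ℕ}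
    (h : subtermAt (u.subst σ) p ≠ none) (hu : subtermAt u p = none) :
    ∃ (q q' : List ℕ) (x : V), p = q ++ q' ∧ subtermAt u q = some (Term.var x) := by
  induction p generalizing u with
  | nil => simp [subtermAt_nil] at hu
  | cons i p ih =>
    cases u with
    | var x => exact ⟨[], i :: p, x, rfl, rfl⟩
    | @func n f ts =>
      by_cases hi : i < n
      · simp only [Term.subst, subtermAt, hi, dite_true] at h hu
        obtain ⟨q, q', x, rfl, hq⟩ := ih h hu
        exact ⟨i :: q, q', x, rfl, by simpa [subtermAt, hi] using hq⟩
      · simp [Term.subst, subtermAt, hi] at h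

/-! ### Most general terms with a prescribed position -/

/-- The most general term that shares with `s` the function symbols strictly above the
position; the remaining subterms are variables named by their positions. -/
def skeleton (f : List ℕ → V) : L.Term V → List ℕ → L.Term V
  | _, [] => Term.var (f [])
  | Term.var _, _ :: _ => Term.var (f [])
  | Term.func g ts, i :: p => Term.func g fun j =>
      -- The naming is shifted by `i`, so a variable deep inside the argument is still named by its
      -- position in the whole term.
      if j.val = i then skeleton (fun q => f (i :: q)) (ts j) p else Term.var (f [j.val])

theorem vars_skeleton (f : List ℕ → V) (s : L.Term V) (p : List ℕ) :
    vars (skeleton f s p) ⊆ Set.range f := by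
  induction p generalizing f s with
  | nil => cases s <;> simp [skeleton, vars]
  | cons i p ih =>
    cases s with
    | var x => simp [skeleton, vars]
    | func g ts =>
      simp only [skeleton, vars]
      refine Set.iUnion_subset fun j => ?_
      split_ifs
      · refine (ih _ _).trans ?_
        rintro _ ⟨q, rfl⟩
        exact ⟨_, rfl⟩
      · simp [vars]

theorem subtermAt_skeleton (f : List ℕ → V) {s : L.Term V} {p : List ℕ}
    (h : subtermAt s p ≠ none) : subtermAt (skeleton f s p) p = some (Term.var (f p)) := by
  induction p generalizing f s with
  | nil => cases s <;> rfl
  | cons i p ih =>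
    cases s with
    | var x => simp [subtermAt] at h
    | @func n g ts =>
      by_cases hi : i < n
      · simp only [subtermAt, hi, dite_true] at h
        simp only [skeleton, subtermAt, hi, dite_true, if_true]
        exact ih _ h
      · simp [subtermAt, hi] at h

/-- Every generalisation of `s` that has the position is an instance of the skeleton. -/
theorem skeleton_subst (f : List ℕ → V) {s s' : L.Term V} {p : List ℕ} {θ τ : Subst L V}
    (h : subtermAt s' p ≠ none) (hs : s'.subst θ = s)
    (hτ : ∀ q t, subtermAt s' q = some t → τ (f q) = t) :
    (skeleton f s p).subst τ = s' := by
  induction p generalizing f s s' with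
  | nil =>
    cases s <;> exact hτ [] s' (subtermAt_nil s')
  | cons i p ih =>
    cases s' with
    | var x => simp [subtermAt] at h
    | @func n g ts =>
      -- As an instance of `s'`, the term `s` has the same root symbol, so the skeleton built from
      -- `s` follows the structure of `s'` down to the position.
      subst hs
      by_cases hi : i < n
      · simp only [subtermAt, hi, dite_true] at h
        simp only [Term.subst, skeleton]
        congr 1
        funext j
        split_ifs with hj
        · subst hj
          refine ih (fun q => f (j.val :: q)) h rfl fun q t hq => hτ _ _ ?_
          rw [subtermAt_func]; exact hq
        · exact hτ [j.val] (ts j) (by rw [subtermAt_func, subtermAt_nil])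
      · simp [subtermAt, hi] at h

/-! ## Unification -/

/-- The number of symbols of a term. -/
def size : L.Term V → ℕ
  | .var _ => 1
  | .func _ ts => 1 + ∑ i, size (ts i)

theorem size_pos (t : L.Term V) : 0 < size t := by
  cases t <;> simp [size]

theorem size_le_subst {t : L.Term V} {x : V} (h : x ∈ vars t) (θ : Subst L V) :
    size (θ x) ≤ size (t.subst θ) := by
  induction t with
  | var y => simp only [vars, Set.mem_singleton_iff] at h; subst h; exact le_rfl
  | func f ts ih =>
    simp only [vars, Set.mem_iUnion] at h
    obtain ⟨i, hi⟩ := h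
    have := Finset.single_le_sum (f := fun i => size ((ts i).subst θ)) (fun _ _ => Nat.zero_le _)
      (Finset.mem_univ i)
    simp only [Term.subst, size]
    exact (ih i hi).trans (this.trans (by omega))

/-- The occurs check: if `x` lay strictly inside `t`, then `t.subst θ` would have more symbols than
its subterm `θ x`. -/
theorem eq_var_of_unifies {t : L.Term V} {x : V} (h : x ∈ vars t) {θ : Subst L V}
    (hθ : θ x = t.subst θ) : t = Term.var x := by
  cases t with
  | var y => simp only [vars, Set.mem_singleton_iff] at h; rw [h]
  | func f ts =>
    exfalso
    simp only [vars, Set.mem_iUnion] at h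
    obtain ⟨i, hi⟩ := h
    have h1 := Finset.single_le_sum (f := fun i => size ((ts i).subst θ))
      (fun _ _ => Nat.zero_le _) (Finset.mem_univ i)
    have h2 := size_le_subst hi θ
    have h3 := congrArg size hθ
    simp only [Term.subst, size] at h3
    omega

/-- A most general unifier of a set of equations is determined by what it has to satisfy on
equivalent sets. -/
theorem IsMGU.of_equiv {E E' : Set (L.Term V × L.Term V)} {μ : Subst L V} (h : IsMGU E μ)
    (hu : ∀ θ : Subst L V,
      (∀ e ∈ E, e.1.subst θ = e.2.subst θ) ↔ ∀ e ∈ E', e.1.subst θ = e.2.subst θ)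
    (hv : ∀ x, (∃ e ∈ E, x ∈ vars e.1 ∪ vars e.2) → ∃ e ∈ E', x ∈ vars e.1 ∪ vars e.2) :
    IsMGU E' μ :=
  ⟨(hu μ).1 h.1, fun θ hθ => h.2.1 θ ((hu θ).2 hθ), h.2.2.1,
    fun x hx => ⟨hv x (h.2.2.2 x hx).1, fun y hy => hv y ((h.2.2.2 x hx).2 y hy)⟩⟩

/-- By idempotence, `θ = μρ` gives `μθ = μμρ = μρ = θ`. Thus applying an mgu before a grounding
unifier does not change ground instances, which is all that has to be known about the mgus in the
inferences. -/
theorem IsMGU.comp_eq {E : Set (L.Term V × L.Term V)} {μ θ : Subst L V} (h : IsMGU E μ)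
    (hθ : ∀ e ∈ E, e.1.subst θ = e.2.subst θ) : μ.comp θ = θ := by
  obtain ⟨ρ, rfl⟩ := h.2.1 θ hθ
  have := h.2.2.1
  funext x
  have hx := congrFun this x
  simp only [Subst.comp] at hx ⊢
  rw [← subst_subst, hx]

theorem isMGU_empty : IsMGU (∅ : Set (L.Term V × L.Term V)) Term.var :=
  ⟨by simp, fun θ _ => ⟨θ, rfl⟩, rfl, fun x hx => absurd rfl hx⟩

section

open Classical in
/-- The substitution `[x := t]`. -/
noncomputable def bind (x : V) (t : L.Term V) : Subst L V := Function.update Term.var x t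

theorem bind_self (x : V) (t : L.Term V) : bind x t x = t := by simp [bind]

theorem bind_of_ne {x y : V} (h : y ≠ x) (t : L.Term V) : bind x t y = Term.var y := by
  simp [bind, h]

theorem subst_bind {x : V} {t : L.Term V} {θ : Subst L V} (h : θ x = t.subst θ) :
    (bind x t).comp θ = θ := by
  funext y
  by_cases hy : y = x
  · subst hy; simp only [Subst.comp, bind_self, h]
  · simp only [Subst.comp, bind_of_ne hy]; rfl

/-- Variable elimination. Every unifier `θ` of the full problem satisfies `θ x = tθ`, so it absorbs
the binding and unifies the reduced problem. For idempotence it matters that `x` has disappeared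
from the reduced problem and that `μ` introduces no variables from outside it. -/
theorem IsMGU.bind {E : List (L.Term V × L.Term V)} {x : V} {t : L.Term V} {μ : Subst L V}
    (hx : x ∉ vars t)
    (h : IsMGU {e | e ∈ E.map fun e => (e.1.subst (bind x t), e.2.subst (bind x t))} μ) :
    IsMGU {e | e ∈ (Term.var x, t) :: E} ((bind x t).comp μ) := by
  have hvar : ∀ y, (∃ e ∈ E.map fun e => (e.1.subst (SCLEQ.bind x t), e.2.subst (SCLEQ.bind x t)),
      y ∈ vars e.1 ∪ vars e.2) →
      y ≠ x ∧ ∃ e ∈ (Term.var x, t) :: E, y ∈ vars e.1 ∪ vars e.2 := by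
    have key : ∀ (s : L.Term V) y, y ∈ vars (s.subst (SCLEQ.bind x t)) →
        y ≠ x ∧ (y ∈ vars s ∨ y ∈ vars t) := by
      intro s y hy
      obtain ⟨z, hz, hy⟩ := mem_vars_subst.1 hy
      by_cases hzx : z = x
      · subst hzx
        rw [bind_self] at hy
        exact ⟨fun h => hx (by rwa [h] at hy), Or.inr hy⟩
      · rw [bind_of_ne hzx] at hy
        simp only [vars, Set.mem_singleton_iff] at hy
        subst hy
        exact ⟨hzx, Or.inl hz⟩
    rintro y ⟨e, he, hy⟩
    obtain ⟨e', he', rfl⟩ := List.mem_map.1 he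
    rcases hy with hy | hy
    · obtain ⟨h1, h2 | h2⟩ := key _ _ hy
      · exact ⟨h1, e', List.mem_cons_of_mem _ he', Or.inl h2⟩
      · exact ⟨h1, _, List.mem_cons_self, Or.inr h2⟩
    · obtain ⟨h1, h2 | h2⟩ := key _ _ hy
      · exact ⟨h1, e', List.mem_cons_of_mem _ he', Or.inr h2⟩
      · exact ⟨h1, _, List.mem_cons_self, Or.inr h2⟩
  have htx : t.subst (SCLEQ.bind x t) = t :=
    subst_eq_self fun y hy => bind_of_ne (by rintro rfl; exact hx hy) t
  have hμx : ∀ y, y ≠ x → x ∉ vars (μ y) := by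
    intro y hy hxy
    by_cases hd : y ∈ μ.dom
    · exact (hvar x ((h.2.2.2 y hd).2 x hxy)).1 rfl
    · rw [not_not.1 hd] at hxy
      simp only [vars, Set.mem_singleton_iff] at hxy
      exact hy hxy.symm
  have hbμ : ∀ s : L.Term V, x ∉ vars s → (s.subst μ).subst (SCLEQ.bind x t) = s.subst μ := by
    intro s hs
    refine subst_eq_self fun y hy => bind_of_ne ?_ t
    rintro rfl
    obtain ⟨z, hz, hy⟩ := mem_vars_subst.1 hy
    exact hμx z (fun h => hs (h ▸ hz)) hy
  have hμμ : ∀ s : L.Term V, (s.subst μ).subst μ = s.subst μ := by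
    intro s; rw [subst_subst, h.2.2.1]
  refine ⟨?_, ?_, ?_, ?_⟩
  · intro e he
    rcases List.mem_cons.1 he with rfl | he
    · simp only [Term.subst, Subst.comp, bind_self, ← subst_subst, htx]
    · simp only [← subst_subst]
      exact h.1 (e.1.subst _, e.2.subst _) (List.mem_map.2 ⟨e, he, rfl⟩)
  · intro θ hθ
    have hb : (SCLEQ.bind x t).comp θ = θ := subst_bind (hθ _ List.mem_cons_self)
    obtain ⟨ρ, hρ⟩ := h.2.1 θ (by
      intro e he
      obtain ⟨e', he', rfl⟩ := List.mem_map.1 he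
      simp only [subst_subst, hb]
      exact hθ e' (List.mem_cons_of_mem _ he'))
    refine ⟨ρ, ?_⟩
    conv_lhs => rw [← hb, hρ]
    funext y
    simp only [Subst.comp, ← subst_subst]
  · funext y
    by_cases hy : y = x
    · subst hy
      simp only [Subst.comp, bind_self]
      rw [← subst_subst, hbμ t hx, hμμ]
    · have := hbμ (Term.var y) (by simpa [vars] using Ne.symm hy)
      have h2 := hμμ (Term.var y)
      simp only [Term.subst] at this h2
      simp only [Subst.comp, bind_of_ne hy, Term.subst, ← subst_subst]
      rw [this, h2]
  · intro y hy
    by_cases hyx : y = x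
    · subst hyx
      refine ⟨⟨_, List.mem_cons_self, Or.inl rfl⟩, fun z hz => ?_⟩
      simp only [Subst.comp, bind_self] at hz
      obtain ⟨a, ha, hz⟩ := mem_vars_subst.1 hz
      by_cases hd : a ∈ μ.dom
      · exact (hvar z ((h.2.2.2 a hd).2 z hz)).2
      · rw [not_not.1 hd] at hz
        simp only [vars, Set.mem_singleton_iff] at hz
        exact ⟨_, List.mem_cons_self, Or.inr (hz ▸ ha)⟩
    · have he : (SCLEQ.bind x t).comp μ y = μ y := by
        simp only [Subst.comp, bind_of_ne hyx]; rfl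
      have hd : y ∈ μ.dom := by
        simp only [Subst.dom, Set.mem_ofPred_eq, he] at hy ⊢
        exact hy
      rw [he]
      exact ⟨(hvar y (h.2.2.2 y hd).1).2, fun z hz => (hvar z ((h.2.2.2 y hd).2 z hz)).2⟩

/-- Unification by decomposition and elimination. The known unifier `θ` rules out clashes and
failing occurs checks, and it also supplies the measure: the total size of the left sides under `θ`.
Elimination does not enlarge the instances, because the binding is absorbed by `θ`, and it removes
one equation; decomposition removes a root symbol. -/
theorem exists_isMGU (θ : Subst L V) (n : ℕ) (E : List (L.Term V × L.Term V))
    (hE : ∀ e ∈ E, e.1.subst θ = e.2.subst θ)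
    (hn : (E.map fun e => size (e.1.subst θ)).sum = n) :
    ∃ μ : Subst L V, IsMGU {e | e ∈ E} μ := by
  induction n using Nat.strong_induction_on generalizing E with
  | _ n ih =>
  match E with
  | [] => exact ⟨Term.var, by simpa using isMGU_empty⟩
  | (s, t) :: E =>
    have hst : s.subst θ = t.subst θ := hE (s, t) List.mem_cons_self
    have hE' : ∀ e ∈ E, e.1.subst θ = e.2.subst θ := fun e he => hE e (List.mem_cons_of_mem _ he)
    simp only [List.map_cons, List.sum_cons] at hn
    have hs := size_pos (s.subst θ)
    have hvar : ∀ (x : V) (t : L.Term V), θ x = t.subst θ →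
        ∃ μ : Subst L V, IsMGU {e | e ∈ (Term.var x, t) :: E} μ := by
      intro x t hxt
      by_cases hx : x ∈ vars t
      · obtain rfl := eq_var_of_unifies hx hxt
        obtain ⟨μ, hμ⟩ := ih _ (by omega) E hE' rfl
        refine ⟨μ, hμ.of_equiv (fun θ => by simp) fun y ⟨e, he, hy⟩ =>
          ⟨e, List.mem_cons_of_mem _ he, hy⟩⟩
      · obtain ⟨μ, hμ⟩ := ih ((E.map fun e => size (e.1.subst θ)).sum) (by omega)
          (E.map fun e => (e.1.subst (SCLEQ.bind x t), e.2.subst (SCLEQ.bind x t))) (by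
            intro e he
            obtain ⟨e', he', rfl⟩ := List.mem_map.1 he
            simp only [subst_subst, subst_bind hxt]
            exact hE' e' he')
          (by simp only [List.map_map, Function.comp_def, subst_subst, subst_bind hxt])
        exact ⟨_, hμ.bind hx⟩
    cases s with
    | var x => exact hvar x t hst
    | @func m f ts =>
      cases t with
      | var x =>
        obtain ⟨μ, hμ⟩ := hvar x (Term.func f ts) hst.symm
        refine ⟨μ, hμ.of_equiv (fun θ => by simp [eq_comm]) ?_⟩
        rintro y ⟨e, he, hy⟩
        rcases List.mem_cons.1 he with rfl | he
        · exact ⟨_, List.mem_cons_self, hy.symm⟩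
        · exact ⟨e, List.mem_cons_of_mem _ he, hy⟩
      | @func m' g ss =>
        have hst' := hst
        simp only [Term.subst, Term.func.injEq] at hst'
        obtain ⟨rfl, hfg, hargs⟩ := hst'
        obtain rfl := eq_of_heq hfg
        have hargs := eq_of_heq hargs
        have hsum : ((List.ofFn (fun i => (ts i, ss i)) ++ E).map
            fun e => size (e.1.subst θ)).sum < n := by
          simp only [List.map_append, List.sum_append, List.map_ofFn, List.sum_ofFn,
            Function.comp_def]
          simp only [Term.subst, size] at hn
          omega
        obtain ⟨μ, hμ⟩ := ih _ hsum (List.ofFn (fun i => (ts i, ss i)) ++ E) (by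
          intro e he
          rcases List.mem_append.1 he with he | he
          · obtain ⟨i, rfl⟩ := (List.mem_ofFn' _ _).1 he
            exact congrFun hargs i
          · exact hE' e he) rfl
        refine ⟨μ, hμ.of_equiv ?_ ?_⟩
        · intro θ
          simp only [Set.mem_ofPred_eq, List.mem_append, List.mem_cons, or_imp, forall_and,
            forall_eq, Term.subst, Term.func.injEq, heq_eq_eq, true_and]
          refine and_congr_left' ?_
          constructor
          · intro h; funext i; exact h (ts i, ss i) ((List.mem_ofFn' _ _).2 ⟨i, rfl⟩)
          · intro h e he
            obtain ⟨i, rfl⟩ := (List.mem_ofFn' _ _).1 he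
            exact congrFun h i
        · rintro y ⟨e, he, hy⟩
          rcases List.mem_append.1 he with he | he
          · obtain ⟨i, rfl⟩ := (List.mem_ofFn' _ _).1 he
            refine ⟨_, List.mem_cons_self, ?_⟩
            simp only [vars, Set.mem_union, Set.mem_iUnion]
            exact hy.imp (fun h => ⟨i, h⟩) fun h => ⟨i, h⟩
          · exact ⟨e, List.mem_cons_of_mem _ he, hy⟩

end

theorem exists_isMGU_pair {s t : L.Term V} {θ : Subst L V} (h : s.subst θ = t.subst θ) :
    ∃ μ : Subst L V, IsMGU {(s, t)} μ := by
  obtain ⟨μ, hμ⟩ := exists_isMGU θ _ [(s, t)] (by simpa using h) rfl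
  exact ⟨μ, by simpa using hμ⟩

/-! ## Orderings -/

theorem subtermAt_replaceAt {u : L.Term V} {p : List ℕ} (h : subtermAt u p ≠ none)
    (s : L.Term V) : subtermAt (replaceAt u p s) p = some s := by
  induction p generalizing u with
  | nil => rw [replaceAt_nil, subtermAt_nil]
  | cons i p ih =>
    obtain ⟨t, ht⟩ := Option.ne_none_iff_exists'.mp h
    obtain ⟨n, f, ts, j, rfl, rfl, h'⟩ := exists_of_subtermAt_cons ht
    rw [replaceAt_func, subtermAt_func, Function.update_self]
    exact ih (by simp [h'])

theorem IsDesired.irrefl {lt : L.Term V → L.Term V → Prop} (hlt : IsDesired lt) (t : L.Term V) :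
    ¬ lt t t := hlt.wf.irrefl.irrefl t

/-- If `u` were below its subterm `s` at `p`, compatibility with contexts would give `u[u]_p ≺
u[s]_p = u`. Now `u[u]_p` is again below its own subterm `u` at `p`, so the descent never ends.
Together with totality this yields the subterm property on ground terms, which `IsDesired` does not
postulate. -/
theorem IsDesired.not_lt_subterm {lt : L.Term V → L.Term V → Prop} (hlt : IsDesired lt)
    {u s : L.Term V} {p : List ℕ} (hp : subtermAt u p = some s) : ¬ lt u s := by
  induction u using hlt.wf.induction generalizing s with
  | _ u ih =>
    intro h
    have hne : subtermAt u p ≠ none := by simp [hp]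
    have h' := hlt.context _ _ u p hne h
    rw [replaceAt_self hp] at h'
    exact ih _ h' (subtermAt_replaceAt hne u) h'

theorem IsDesired.subterm_eq_or_lt {lt : L.Term V → L.Term V → Prop} (hlt : IsDesired lt)
    {u s : L.Term V} {p : List ℕ} (hp : subtermAt u p = some s) (hu : vars u = ∅) :
    s = u ∨ lt s u := by
  have hs : vars s = ∅ := Set.subset_empty_iff.1 (hu ▸ vars_subtermAt hp)
  rcases hlt.total s u hs hu with h | h | h
  · exact Or.inr h
  · exact Or.inl h
  · exact absurd h (hlt.not_lt_subterm hp)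

theorem mulExt_singleton_right {α : Type*} {r : α → α → Prop} {M : Multiset α} {b : α} :
    MulExt r M {b} ↔ ∀ x ∈ M, r x b := by
  constructor
  · rintro ⟨X, Y, Z, hY, rfl, h, hX⟩ x hx
    have hZ : Z = 0 := by
      have hc := congrArg Multiset.card h
      have := Multiset.card_pos.2 hY
      simp only [Multiset.card_singleton, Multiset.card_add] at hc
      exact Multiset.card_eq_zero.1 (by omega)
    subst hZ
    rw [zero_add] at h hx
    obtain ⟨y, hy, hxy⟩ := hX x hx
    rw [← h, Multiset.mem_singleton] at hy
    exact hy ▸ hxy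
  · intro h
    exact ⟨M, {b}, 0, by simp, by simp, by simp, fun x hx => ⟨b, by simp, h x hx⟩⟩

theorem mulExt_singleton_left {α : Type*} {r : α → α → Prop} {M : Multiset α} {b : α}
    (h : MulExt r {b} M) : ∃ y ∈ M, b = y ∨ r b y := by
  obtain ⟨X, Y, Z, -, h, rfl, hX⟩ := h
  have hb : b ∈ Z + X := h ▸ Multiset.mem_singleton_self b
  rcases Multiset.mem_add.1 hb with hb | hb
  · exact ⟨b, Multiset.mem_add.2 (Or.inl hb), Or.inl rfl⟩
  · obtain ⟨y, hy, hby⟩ := hX b hb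
    exact ⟨y, Multiset.mem_add.2 (Or.inr hy), Or.inr hby⟩

theorem termMultiset_true (s t : L.Term V) :
    (⟨true, s(s, t)⟩ : Lit L V).termMultiset = {s} + {t} := rfl

theorem termMultiset_false (s t : L.Term V) :
    (⟨false, s(s, t)⟩ : Lit L V).termMultiset = ({s} + {t}) + ({s} + {t}) := rfl

theorem mem_termMultiset {K : Lit L V} {t : L.Term V} : t ∈ K.termMultiset ↔ t ∈ K.eqn := by
  rcases K with ⟨b, e⟩
  induction e using Sym2.ind with
  | _ x y =>
    cases b
    · simp only [termMultiset_false, Multiset.mem_add, Multiset.mem_singleton, Sym2.mem_iff, or_self]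
    · simp only [termMultiset_true, Multiset.mem_add, Multiset.mem_singleton, Sym2.mem_iff]

theorem litLtTerm_iff {lt : L.Term V → L.Term V → Prop} {K : Lit L V} {β : L.Term V} :
    LitLtTerm lt K β ↔ ∀ t ∈ K.eqn, lt t β := by
  simp only [LitLtTerm, mulExt_singleton_right, mem_termMultiset]

theorem clauseLtTerm_iff {lt : L.Term V → L.Term V → Prop} {C : Clause L V} {β : L.Term V} :
    ClauseLtTerm lt C β ↔ ∀ K ∈ C, LitLtTerm lt K β := by
  simp only [ClauseLtTerm, mulExt_singleton_right, Multiset.mem_map, forall_exists_index, and_imp,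
    forall_apply_eq_imp_iff₂, LitLtTerm]

theorem IsDesired.not_termLtLit {lt : L.Term V → L.Term V → Prop} (hlt : IsDesired lt)
    {K : Lit L V} {β : L.Term V} (h : LitLtTerm lt K β) : ¬ TermLtLit lt β K := by
  intro h'
  obtain ⟨y, hy, hβ⟩ := mulExt_singleton_left h'
  have hyβ := litLtTerm_iff.1 h y (mem_termMultiset.1 hy)
  rcases hβ with rfl | hβ
  · exact hlt.irrefl _ hyβ
  · exact hlt.irrefl _ (hlt.trans _ _ _ hyβ hβ)

theorem Lit.ground_iff {K : Lit L V} : K.Ground ↔ ∀ t ∈ K.eqn, SCLEQ.vars t = ∅ := by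
  simp only [Lit.Ground, Lit.vars, Set.eq_empty_iff_forall_notMem, Set.mem_ofPred_eq, not_exists,
    not_and]
  exact ⟨fun h t ht x hx => h x t ht hx, fun h x t ht hx => h t ht x hx⟩

theorem IsDesired.litLtTerm_or {lt : L.Term V → L.Term V → Prop} (hlt : IsDesired lt)
    {K : Lit L V} {β : L.Term V} (hK : K.Ground) (hβ : vars β = ∅) :
    LitLtTerm lt K β ∨ TermLtLit lt β K := by
  by_cases h : ∀ t ∈ K.eqn, lt t β
  · exact Or.inl (litLtTerm_iff.2 h)
  · push Not at h
    obtain ⟨t, ht, htβ⟩ := h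
    right
    rcases hlt.total t β (Lit.ground_iff.1 hK t ht) hβ with h | rfl | h
    · exact absurd h htβ
    -- Here a side equals `β`. The multiset of a literal has at least two elements, so `{β}` is a
    -- proper submultiset of it and hence smaller.
    · obtain ⟨M, hM⟩ := Multiset.exists_cons_of_mem (mem_termMultiset.2 ht)
      refine ⟨0, M, {t}, ?_, by simp, by rw [hM, Multiset.singleton_add], by simp⟩
      rintro rfl
      have hc := congrArg Multiset.card hM
      rcases K with ⟨b, e⟩
      induction e using Sym2.ind with
      | _ x y => cases b <;> simp [termMultiset_true, termMultiset_false] at hc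
    · refine ⟨{β}, K.termMultiset, 0, ?_, by simp, by simp, ?_⟩
      · intro h0
        have := mem_termMultiset.2 ht
        simp [h0] at this
      · intro x hx
        obtain rfl := Multiset.mem_singleton.1 hx
        exact ⟨t, mem_termMultiset.2 ht, h⟩

theorem litLt_of_lt {lt : L.Term V → L.Term V → Prop} {s s' : L.Term V} (h : lt s' s) (b : Bool)
    (t : L.Term V) : LitLt lt ⟨b, s(s', t)⟩ ⟨b, s(s, t)⟩ := by
  cases b
  · refine ⟨{s'} + {s'}, {s} + {s}, {t} + {t}, by simp, ?_, ?_, ?_⟩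
    · rw [termMultiset_false]; abel
    · rw [termMultiset_false]; abel
    · intro x hx
      simp only [Multiset.mem_add, Multiset.mem_singleton, or_self] at hx
      exact ⟨s, by simp, hx ▸ h⟩
  · refine ⟨{s'}, {s}, {t}, by simp, ?_, ?_, ?_⟩
    · rw [termMultiset_true, add_comm]
    · rw [termMultiset_true, add_comm]
    · intro x hx
      exact ⟨s, by simp, (Multiset.mem_singleton.1 hx) ▸ h⟩

theorem mulExt_cons_of_rel {α : Type*} {r : α → α → Prop} {a b : α} (h : r a b) (M : Multiset α) :
    MulExt r (a ::ₘ M) (b ::ₘ M) :=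
  ⟨{a}, {b}, M, by simp, by rw [add_comm, Multiset.singleton_add],
    by rw [add_comm, Multiset.singleton_add],
    fun x hx => ⟨b, by simp, (Multiset.mem_singleton.1 hx) ▸ h⟩⟩

/-! ## Entailment -/

theorem Lit.subst_mk (b : Bool) (s t : L.Term V) (σ : Subst L V) :
    Lit.subst ⟨b, s(s, t)⟩ σ = ⟨b, s(s.subst σ, t.subst σ)⟩ := rfl

theorem Lit.comp_comp (K : Lit L V) : K.comp.comp = K := by
  simp [Lit.comp]

theorem Lit.exists_eq (K : Lit L V) : ∃ b s t, K = ⟨b, s(s, t)⟩ := by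
  rcases K with ⟨b, e⟩
  induction e using Sym2.ind with
  | _ x y => exact ⟨b, x, y, rfl⟩

theorem Lit.ground_mk {b : Bool} {s t : L.Term V} :
    Lit.Ground (⟨b, s(s, t)⟩ : Lit L V) ↔ SCLEQ.vars s = ∅ ∧ SCLEQ.vars t = ∅ := by
  simp [Lit.ground_iff]

theorem litLtTerm_mk {lt : L.Term V → L.Term V → Prop} {b : Bool} {s t β : L.Term V} :
    LitLtTerm lt ⟨b, s(s, t)⟩ β ↔ lt s β ∧ lt t β := by
  simp [litLtTerm_iff]

section

variable {M : Type*} [L.Structure M] {a : V → M}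

theorem holds_true {s t : L.Term V} :
    Lit.Holds a ⟨true, s(s, t)⟩ ↔ s.realize a = t.realize a := by
  simp [Lit.Holds]

theorem holds_comp {K : Lit L V} : Lit.Holds a K.comp ↔ ¬ Lit.Holds a K := by
  rcases K with ⟨b, e⟩
  cases b <;> simp [Lit.Holds, Lit.comp]

theorem holds_congr {b : Bool} {s t s' t' : L.Term V} (hs : s.realize a = s'.realize a)
    (ht : t.realize a = t'.realize a) :
    Lit.Holds a ⟨b, s(s, t)⟩ ↔ Lit.Holds a ⟨b, s(s', t')⟩ := by
  cases b <;> simp [Lit.Holds, hs, ht]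

theorem realize_replaceAt {u s t : L.Term V} {p : List ℕ} (hp : subtermAt u p = some s)
    (h : t.realize a = s.realize a) : (replaceAt u p t).realize a = u.realize a := by
  induction p generalizing u with
  | nil =>
    rw [subtermAt_nil] at hp
    rw [replaceAt_nil, Option.some.inj hp, h]
  | cons i p ih =>
    obtain ⟨n, f, ts, j, rfl, rfl, h'⟩ := exists_of_subtermAt_cons hp
    rw [replaceAt_func, Term.realize_func, Term.realize_func]
    congr 1
    funext k
    by_cases hk : k = j
    · subst hk; rw [Function.update_self]; exact ih h'
    · rw [Function.update_of_ne hk]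

end

theorem Entails.mono {G G' : Set (Lit L V)} (h : G ⊆ G') {K : Lit L V} (hK : Entails G K) :
    Entails G' K := fun M _ _ a hG => hK M a fun H hH => hG H (h hH)

theorem Entails.of_mem {G : Set (Lit L V)} {K : Lit L V} (h : K ∈ G) : Entails G K :=
  fun _ _ _ _ hG => hG K h

theorem Defined.mono {G G' : Set (Lit L V)} (h : G ⊆ G') {K : Lit L V} (hK : Defined G K) :
    Defined G' K := hK.imp (Entails.mono h) (Entails.mono h)

theorem defined_comp {G : Set (Lit L V)} {K : Lit L V} : Defined G K.comp ↔ Defined G K := by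
  simp only [Defined, Lit.comp_comp, or_comm]

theorem Defined.of_mem {G : Set (Lit L V)} {K : Lit L V} (h : K ∈ G) : Defined G K :=
  Or.inl (Entails.of_mem h)

theorem defined_congr {G : Set (Lit L V)} {b : Bool} {s t s' t' : L.Term V}
    (hs : Entails G ⟨true, s(s, s')⟩) (ht : Entails G ⟨true, s(t, t')⟩) :
    Defined G ⟨b, s(s, t)⟩ ↔ Defined G ⟨b, s(s', t')⟩ := by
  have key : ∀ b, Entails G ⟨b, s(s, t)⟩ ↔ Entails G ⟨b, s(s', t')⟩ := fun b => by
    constructor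
    · intro h M _ _ a hG
      exact (holds_congr (holds_true.1 (hs M a hG)) (holds_true.1 (ht M a hG))).1 (h M a hG)
    · intro h M _ _ a hG
      exact (holds_congr (holds_true.1 (hs M a hG)) (holds_true.1 (ht M a hG))).2 (h M a hG)
  exact or_congr (key b) (key !b)

theorem Entails.refl (G : Set (Lit L V)) (s : L.Term V) : Entails G ⟨true, s(s, s)⟩ :=
  fun _ _ _ _ _ => holds_true.2 rfl

theorem Entails.symm {G : Set (Lit L V)} {s t : L.Term V} (h : Entails G ⟨true, s(s, t)⟩) :
    Entails G ⟨true, s(t, s)⟩ := by rwa [Sym2.eq_swap]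

theorem Entails.trans {G : Set (Lit L V)} {s t r : L.Term V} (h : Entails G ⟨true, s(s, t)⟩)
    (h' : Entails G ⟨true, s(t, r)⟩) : Entails G ⟨true, s(s, r)⟩ :=
  fun M _ _ a hG => holds_true.2 ((holds_true.1 (h M a hG)).trans (holds_true.1 (h' M a hG)))

theorem Entails.replaceAt {G : Set (Lit L V)} {u s t : L.Term V} {p : List ℕ}
    (hp : subtermAt u p = some s) (h : Entails G ⟨true, s(t, s)⟩) :
    Entails G ⟨true, s(SCLEQ.replaceAt u p t, u)⟩ :=
  fun M _ _ a hG => holds_true.2 (realize_replaceAt hp (holds_true.1 (h M a hG)))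

theorem Entails.subst {G : Set (Lit L V)} {t : L.Term V} {σ τ : Subst L V}
    (h : ∀ x ∈ vars t, Entails G ⟨true, s(σ x, τ x)⟩) :
    Entails G ⟨true, s(t.subst σ, t.subst τ)⟩ := by
  induction t with
  | var x => exact h x (by simp [vars])
  | func f ts ih =>
    intro M _ _ a hG
    refine holds_true.2 ?_
    simp only [Term.subst, Term.realize_func]
    congr 1
    funext i
    exact holds_true.1 (ih i (fun x hx => h x (by
      simp only [vars, Set.mem_iUnion]; exact ⟨i, hx⟩)) M a hG)

/-- A congruence on terms that satisfies the literals of `G` satisfies the equations that `G`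
entails. -/
theorem rel_of_entails {G : Set (Lit L V)} (c : Setoid (L.Term V))
    (hc : ∀ (n : ℕ) (f : L.Functions n) (ts ts' : Fin n → L.Term V),
      (∀ i, c.r (ts i) (ts' i)) → c.r (Term.func f ts) (Term.func f ts'))
    (ht : ∀ s t, (⟨true, s(s, t)⟩ : Lit L V) ∈ G → c.r s t)
    (hf : ∀ s t, (⟨false, s(s, t)⟩ : Lit L V) ∈ G → ¬ c.r s t)
    {s t : L.Term V} (h : Entails G ⟨true, s(s, t)⟩) : c.r s t := by
  -- The term model modulo the congruence, which lies in the universe that `Entails` quantifies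
  -- over. Operations are computed on representatives; under the assignment of each variable to its
  -- class, a term evaluates to its class.
  let str : L.Structure (Quotient c) :=
    { funMap := fun {n} f ts => Quotient.mk c (Term.func f fun i => (ts i).out)
      RelMap := fun _ _ => False }
  have hreal : ∀ t : L.Term V, t.realize (fun x => Quotient.mk c (Term.var x)) =
      Quotient.mk c t := by
    intro t
    induction t with
    | var x => rfl
    | func f ts ih =>
      rw [Term.realize_func]
      refine Quotient.sound (hc _ f _ _ fun i => ?_)
      simp only [ih]
      exact Quotient.mk_out (ts i)
  have : Nonempty (Quotient c) := ⟨Quotient.mk c s⟩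
  have hh := h (Quotient c) (fun x => Quotient.mk c (Term.var x)) ?_
  · rw [holds_true, hreal, hreal] at hh
    exact Quotient.exact hh
  · intro H hH
    obtain ⟨b, s, t, rfl⟩ := H.exists_eq
    cases b
    · have := hf s t hH
      simp only [Lit.Holds, Bool.false_eq_true, if_false, Sym2.map_mk, Sym2.mk_isDiag_iff, hreal]
      exact fun h => this (Quotient.exact h)
    · rw [holds_true, hreal, hreal]
      exact Quotient.sound (ht s t hH)

/-- The equations that are entailed by a satisfiable set of literals are entailed by its positive
literals. -/
theorem entails_positive {G : Set (Lit L V)} (hG : ∃ K, ¬ Entails G K) {s t : L.Term V}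
    (h : Entails G ⟨true, s(s, t)⟩) :
    Entails {K | K ∈ G ∧ K.pos = true} ⟨true, s(s, t)⟩ := by
  refine rel_of_entails (G := G)
    ⟨fun s t => Entails {K | K ∈ G ∧ K.pos = true} ⟨true, s(s, t)⟩,
      ⟨Entails.refl _, Entails.symm, Entails.trans⟩⟩ ?_ ?_ ?_ h
  · intro n f ts ts' h M _ _ a hM
    refine holds_true.2 ?_
    rw [Term.realize_func, Term.realize_func]
    congr 1
    funext i
    exact holds_true.1 (h i M a hM)
  · intro s t hst
    exact Entails.of_mem ⟨hst, rfl⟩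
  · intro s t hst hst'
    -- If the positive part entailed an equation whose negation is in `G`, then `G` would have no
    -- model and would entail even `K`.
    obtain ⟨K, hK⟩ := hG
    refine hK fun M _ _ a hM => ?_
    have h1 := hM _ hst
    have h2 := hst' M a fun H hH => hM H hH.1
    exact absurd h2 (holds_comp.1 h1)

/-! ## Ground rewrite systems -/

/-- The rules of `R` are ground and decreasing. -/
def GroundRules (lt : L.Term V → L.Term V → Prop) (R : Set (L.Term V × L.Term V)) : Prop :=
  ∀ e ∈ R, vars e.1 = ∅ ∧ vars e.2 = ∅ ∧ lt e.2 e.1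

theorem groundRules_conv (lt : L.Term V → L.Term V → Prop) (G : Set (Lit L V)) :
    GroundRules lt (conv lt G) := fun _ he => ⟨he.1, he.2.1, he.2.2.1⟩

section

variable {lt : L.Term V → L.Term V → Prop} {R : Set (L.Term V × L.Term V)}

theorem rewrites_of_mem {s : L.Term V} {e : L.Term V × L.Term V} (he : e ∈ R) {p : List ℕ}
    (hp : subtermAt s p = some e.1) : Rewrites R s (replaceAt s p e.2) :=
  ⟨e, he, p, Term.var, by rw [subst_var, hp], by rw [subst_var]⟩

theorem GroundRules.exists_of_rewrites (hR : GroundRules lt R) {s t : L.Term V}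
    (h : Rewrites R s t) : ∃ e ∈ R, ∃ p, subtermAt s p = some e.1 ∧ t = replaceAt s p e.2 := by
  obtain ⟨e, he, p, θ, hp, rfl⟩ := h
  rw [subst_of_ground (hR e he).1] at hp
  exact ⟨e, he, p, hp, by rw [subst_of_ground (hR e he).2.1]⟩

theorem GroundRules.lt_of_rewrites (hlt : IsDesired lt) (hR : GroundRules lt R) {s t : L.Term V}
    (h : Rewrites R s t) : lt t s := by
  obtain ⟨e, he, p, hp, rfl⟩ := hR.exists_of_rewrites h
  have := hlt.context _ _ s p (by simp [hp]) (hR e he).2.2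
  rwa [replaceAt_self hp] at this

theorem GroundRules.ground_of_rewrites (hR : GroundRules lt R) {s t : L.Term V}
    (h : Rewrites R s t) (hs : vars s = ∅) : vars t = ∅ := by
  obtain ⟨e, he, p, hp, rfl⟩ := hR.exists_of_rewrites h
  exact vars_replaceAt_eq_empty hs (hR e he).2.1 p

theorem GroundRules.ground_of_reflTransGen (hR : GroundRules lt R) {s t : L.Term V}
    (h : ReflTransGen (Rewrites R) s t) (hs : vars s = ∅) : vars t = ∅ := by
  induction h with
  | refl => exact hs
  | tail _ h ih => exact hR.ground_of_rewrites h ih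

theorem GroundRules.eq_or_lt (hlt : IsDesired lt) (hR : GroundRules lt R) {s t : L.Term V}
    (h : ReflTransGen (Rewrites R) s t) : t = s ∨ lt t s := by
  induction h with
  | refl => exact Or.inl rfl
  | tail _ h ih =>
    have h' := hR.lt_of_rewrites hlt h
    rcases ih with rfl | ih
    · exact Or.inr h'
    · exact Or.inr (hlt.trans _ _ _ h' ih)

theorem GroundRules.exists_normalForm (hlt : IsDesired lt) (hR : GroundRules lt R)
    (s : L.Term V) : ∃ t, IsNormalForm R t s := by
  induction s using hlt.wf.induction with
  | _ s ih =>
    by_cases h : Irreducible R s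
    · exact ⟨s, ReflTransGen.refl, h⟩
    · simp only [Irreducible, not_forall, not_not] at h
      obtain ⟨t, ht⟩ := h
      obtain ⟨t', h1, h2⟩ := ih t (hR.lt_of_rewrites hlt ht)
      exact ⟨t', ReflTransGen.head ht h1, h2⟩

theorem Rewrites.arg {n : ℕ} {f : L.Functions n} {ts : Fin n → L.Term V} {i : Fin n}
    {t : L.Term V} (h : Rewrites R (ts i) t) :
    Rewrites R (Term.func f ts) (Term.func f (Function.update ts i t)) := by
  obtain ⟨e, he, p, θ, hp, rfl⟩ := h
  exact ⟨e, he, i.val :: p, θ, by rw [subtermAt_func, hp], by rw [replaceAt_func]⟩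

theorem reflTransGen_arg {n : ℕ} {f : L.Functions n} {ts : Fin n → L.Term V} {i : Fin n}
    {t : L.Term V} (h : ReflTransGen (Rewrites R) (ts i) t) :
    ReflTransGen (Rewrites R) (Term.func f ts) (Term.func f (Function.update ts i t)) := by
  induction h with
  | refl => rw [Function.update_eq_self]
  | @tail b c _ hbc ih =>
    have hbc' : Rewrites R (Function.update ts i b i) c := by rwa [Function.update_self]
    have := hbc'.arg (f := f)
    rw [Function.update_idem] at this
    exact ih.tail this

theorem reflTransGen_func {n : ℕ} {f : L.Functions n} {ts ts' : Fin n → L.Term V}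
    (h : ∀ i, ReflTransGen (Rewrites R) (ts i) (ts' i)) :
    ReflTransGen (Rewrites R) (Term.func f ts) (Term.func f ts') := by
  -- The arguments are rewritten one after another; `S` collects those already done.
  have key : ∀ S : Finset (Fin n), ReflTransGen (Rewrites R) (Term.func f ts)
      (Term.func f fun i => if i ∈ S then ts' i else ts i) := by
    intro S
    induction S using Finset.induction_on with
    | empty => simpa using ReflTransGen.refl
    | insert a S ha ih =>
      refine ih.trans ?_
      have hu : (fun i => if i ∈ insert a S then ts' i else ts i) =
          Function.update (fun i => if i ∈ S then ts' i else ts i) a (ts' a) := by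
        funext i
        by_cases hi : i = a
        · subst hi; simp
        · simp [hi]
      rw [hu]
      exact reflTransGen_arg (by simpa [ha] using h a)
  simpa using key Finset.univ

theorem Irreducible.subterm {s t : L.Term V} {p : List ℕ} (h : Irreducible R s)
    (hp : subtermAt s p = some t) : Irreducible R t := by
  rintro t' ⟨e, he, q, θ, hq, rfl⟩
  exact h _ ⟨e, he, p ++ q, θ, by rw [subtermAt_append, hp]; exact hq, rfl⟩

theorem Irreducible.eq_of_reflTransGen {s t : L.Term V} (h : Irreducible R s)
    (hst : ReflTransGen (Rewrites R) s t) : t = s := by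
  rcases hst.cases_head with h' | ⟨x, hx, -⟩
  · exact h'.symm
  · exact absurd hx (h x)

end

/-! ### Confluence and ground completion by superposition -/

/-- Newman's lemma. -/
theorem join_of_locally_confluent {α : Type*} {r : α → α → Prop} {lt : α → α → Prop}
    (wf : WellFounded lt) (hr : ∀ a b, r a b → lt b a)
    (hl : ∀ a b c, r a b → r a c → Join (ReflTransGen r) b c) {a b c : α}
    (hb : ReflTransGen r a b) (hc : ReflTransGen r a c) : Join (ReflTransGen r) b c := by
  induction a using wf.induction generalizing b c with
  | _ a ih =>
    rcases hb.cases_head with rfl | ⟨b', hab, hb⟩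
    · exact ⟨c, hc, ReflTransGen.refl⟩
    rcases hc.cases_head with rfl | ⟨c', hac, hc⟩
    · exact ⟨b, ReflTransGen.refl, hb.head hab⟩
    obtain ⟨d, hbd, hcd⟩ := hl a b' c' hab hac
    obtain ⟨e, hbe, hde⟩ := ih b' (hr _ _ hab) hb hbd
    obtain ⟨g, heg, hcg⟩ := ih c' (hr _ _ hac) (hcd.trans hde) hc
    exact ⟨g, hbe.trans heg, hcg⟩

/-- The equations obtained from the positive literals of `G` by ground superposition. -/
inductive Superposed (lt : L.Term V → L.Term V → Prop) (G : Set (Lit L V)) :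
    L.Term V → L.Term V → Prop
  | of_mem (s t : L.Term V) : (⟨true, s(s, t)⟩ : Lit L V) ∈ G → Superposed lt G s t
  | symm (s t : L.Term V) : Superposed lt G s t → Superposed lt G t s
  | superpose (l r s t : L.Term V) (p : List ℕ) : Superposed lt G l r → lt r l →
      Superposed lt G s t → subtermAt s p = some l → Superposed lt G (replaceAt s p r) t

/-- The rules given by the equations `Superposed lt G`. -/
def superposedRules (lt : L.Term V → L.Term V → Prop) (G : Set (Lit L V)) :
    Set (L.Term V × L.Term V) := {e | Superposed lt G e.1 e.2 ∧ lt e.2 e.1}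

section

variable {lt : L.Term V → L.Term V → Prop} {G : Set (Lit L V)}

theorem Superposed.ground (hG : ∀ K ∈ G, Lit.Ground K) {s t : L.Term V}
    (h : Superposed lt G s t) : vars s = ∅ ∧ vars t = ∅ := by
  induction h with
  | of_mem s t h => exact Lit.ground_mk.1 (hG _ h)
  | symm s t _ ih => exact ih.symm
  | superpose l r s t p _ _ _ _ ih ih' => exact ⟨vars_replaceAt_eq_empty ih'.1 ih.2 p, ih'.2⟩

theorem Superposed.entails {s t : L.Term V} (h : Superposed lt G s t) :
    Entails {K | K ∈ G ∧ K.pos = true} ⟨true, s(s, t)⟩ := by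
  induction h with
  | of_mem s t h => exact Entails.of_mem ⟨h, rfl⟩
  | symm s t _ ih => exact ih.symm
  | superpose l r s t p _ _ _ hp ih ih' => exact (Entails.replaceAt hp ih.symm).trans ih'

theorem groundRules_superposed (hG : ∀ K ∈ G, Lit.Ground K) :
    GroundRules lt (superposedRules lt G) :=
  fun _ he => ⟨(he.1.ground hG).1, (he.1.ground hG).2, he.2⟩

theorem superposedRules_subset_conv (hG : ∀ K ∈ G, Lit.Ground K) :
    superposedRules lt G ⊆ conv lt G :=
  fun _ he => ⟨(he.1.ground hG).1, (he.1.ground hG).2, he.2, he.1.entails⟩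

theorem Rewrites.mono {R R' : Set (L.Term V × L.Term V)} (h : R ⊆ R') {s t : L.Term V}
    (hst : Rewrites R s t) : Rewrites R' s t := by
  obtain ⟨e, he, hh⟩ := hst
  exact ⟨e, h he, hh⟩

/-- Closure under superposition means exactly this, and it is what makes critical pairs joinable. -/
theorem Superposed.rewrites (hG : ∀ K ∈ G, Lit.Ground K) {s s' t : L.Term V}
    (h : Superposed lt G s t) (hs : Rewrites (superposedRules lt G) s s') :
    Superposed lt G s' t := by
  obtain ⟨e, he, p, hp, rfl⟩ := (groundRules_superposed hG).exists_of_rewrites hs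
  exact Superposed.superpose _ _ _ _ p he.1 he.2 h hp

theorem Superposed.join (hlt : IsDesired lt) (hG : ∀ K ∈ G, Lit.Ground K) {s t : L.Term V}
    (h : Superposed lt G s t) : Join (ReflTransGen (Rewrites (superposedRules lt G))) s t := by
  rcases hlt.total s t (h.ground hG).1 (h.ground hG).2 with hst | rfl | hst
  · refine ⟨s, ReflTransGen.refl, ReflTransGen.single ?_⟩
    have := rewrites_of_mem (R := superposedRules lt G) (e := (t, s)) ⟨h.symm, hst⟩
      (subtermAt_nil t)
    rwa [replaceAt_nil] at this
  · exact ⟨s, ReflTransGen.refl, ReflTransGen.refl⟩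
  · refine ⟨t, ReflTransGen.single ?_, ReflTransGen.refl⟩
    have := rewrites_of_mem (R := superposedRules lt G) (e := (s, t)) ⟨h, hst⟩
      (subtermAt_nil s)
    rwa [replaceAt_nil] at this

theorem Join.symm' {α : Type*} {r : α → α → Prop} {a b : α} (h : Join r a b) : Join r b a := by
  obtain ⟨c, h1, h2⟩ := h
  exact ⟨c, h2, h1⟩

/-- If one step is at the root, with rule `t → b`, then rewriting the left side of this rule to `a`
gives the superposed equation `a ≈ b`, and superposed equations are joinable by orienting them.
Steps in different arguments commute, and steps in the same argument are handled by induction. -/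
theorem superposed_locally_confluent (hlt : IsDesired lt) (hG : ∀ K ∈ G, Lit.Ground K)
    (t a b : L.Term V) (ha : Rewrites (superposedRules lt G) t a)
    (hb : Rewrites (superposedRules lt G) t b) :
    Join (ReflTransGen (Rewrites (superposedRules lt G))) a b := by
  have hR := groundRules_superposed (lt := lt) hG
  have root : ∀ (t a b : L.Term V) (e : L.Term V × L.Term V), e ∈ superposedRules lt G →
      subtermAt t [] = some e.1 → b = replaceAt t [] e.2 → Rewrites (superposedRules lt G) t a →
      Join (ReflTransGen (Rewrites (superposedRules lt G))) a b := by
    intro t a b e he ht hb ha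
    rw [subtermAt_nil] at ht
    rw [replaceAt_nil] at hb
    obtain rfl := Option.some.inj ht
    subst hb
    exact (he.1.rewrites hG ha).join hlt hG
  induction t generalizing a b with
  | var x =>
    obtain ⟨e, he, p, hp, hb⟩ := hR.exists_of_rewrites hb
    cases p with
    | nil => exact root _ _ _ e he hp hb ha
    | cons i p => simp [subtermAt] at hp
  | @func n f ts ih =>
    obtain ⟨e, he, p, hp, hb'⟩ := hR.exists_of_rewrites hb
    obtain ⟨e', he', q, hq, ha'⟩ := hR.exists_of_rewrites ha
    cases p with
    | nil => exact root _ _ _ e he hp hb' ha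
    | cons i p =>
      cases q with
      | nil => exact Join.symm' (root _ _ _ e' he' hq ha' hb)
      | cons j q =>
        by_cases hi : i < n
        swap
        · simp [subtermAt, hi] at hp
        by_cases hj : j < n
        swap
        · simp [subtermAt, hj] at hq
        have hpi : subtermAt (ts ⟨i, hi⟩) p = some e.1 := by simpa [subtermAt, hi] using hp
        have hqj : subtermAt (ts ⟨j, hj⟩) q = some e'.1 := by simpa [subtermAt, hj] using hq
        have hbi := rewrites_of_mem he hpi
        have haj := rewrites_of_mem he' hqj
        rw [show i = (⟨i, hi⟩ : Fin n).val from rfl, replaceAt_func] at hb'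
        rw [show j = (⟨j, hj⟩ : Fin n).val from rfl, replaceAt_func] at ha'
        generalize (⟨i, hi⟩ : Fin n) = i' at *
        generalize (⟨j, hj⟩ : Fin n) = j' at *
        subst ha' hb'
        by_cases hij : i' = j'
        · subst hij
          obtain ⟨d, h1, h2⟩ := ih i' _ _ haj hbi
          refine ⟨Term.func f (Function.update ts i' d), ?_, ?_⟩
          · have := reflTransGen_arg (f := f) (i := i')
              (ts := Function.update ts i' (replaceAt (ts i') q e'.2)) (t := d)
              (R := superposedRules lt G) (by rwa [Function.update_self])
            rwa [Function.update_idem] at this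
          · have := reflTransGen_arg (f := f) (i := i')
              (ts := Function.update ts i' (replaceAt (ts i') p e.2)) (t := d)
              (R := superposedRules lt G) (by rwa [Function.update_self])
            rwa [Function.update_idem] at this
        · refine ⟨Term.func f (Function.update (Function.update ts j' (replaceAt (ts j') q e'.2)) i'
            (replaceAt (ts i') p e.2)), ReflTransGen.single ?_, ReflTransGen.single ?_⟩
          · refine Rewrites.arg ?_
            rwa [Function.update_of_ne hij]
          · rw [Function.update_comm (Ne.symm hij)]
            refine Rewrites.arg ?_
            rwa [Function.update_of_ne (Ne.symm hij)]

/-- Ground completion: equations that follow from the positive literals of `G` are joinable by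
the rules obtained by superposition. -/
theorem join_of_entails (hlt : IsDesired lt) (hG : ∀ K ∈ G, Lit.Ground K) {s t : L.Term V}
    (h : Entails {K | K ∈ G ∧ K.pos = true} ⟨true, s(s, t)⟩) :
    Join (ReflTransGen (Rewrites (superposedRules lt G))) s t := by
  have hR := groundRules_superposed (lt := lt) hG
  have hconf : ∀ a b c : L.Term V, ReflTransGen (Rewrites (superposedRules lt G)) a b →
      ReflTransGen (Rewrites (superposedRules lt G)) a c →
      Join (ReflTransGen (Rewrites (superposedRules lt G))) b c := fun a b c =>
    join_of_locally_confluent hlt.wf (fun a b h => hR.lt_of_rewrites hlt h)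
      (superposed_locally_confluent hlt hG)
  -- By confluence, joinability is an equivalence relation. It is a congruence containing the
  -- positive literals of `G`, so it contains every equation they entail.
  refine rel_of_entails ⟨_, equivalence_join hconf⟩ ?_ ?_ ?_ h
  · intro n f ts ts' hts
    choose d h1 h2 using hts
    exact ⟨Term.func f d, reflTransGen_func h1, reflTransGen_func h2⟩
  · intro s t hst
    exact (Superposed.of_mem s t hst.1).join hlt hG
  · intro s t hst
    exact absurd hst.2 (by simp)

/-- The sides of a rule `l → r` of `conv` are joinable by superposed rules. If `l` is irreducible
for these, then `r` must rewrite to `l`, which is impossible since rewriting decreases and `r ≺ l`.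
So the normal forms reached with superposed rules are those that reduction chains ask for. -/
theorem irreducible_conv (hlt : IsDesired lt) (hG : ∀ K ∈ G, Lit.Ground K) {s : L.Term V}
    (h : Irreducible (superposedRules lt G) s) : Irreducible (conv lt G) s := by
  intro s' hs'
  obtain ⟨e, he, p, hp, rfl⟩ := (groundRules_conv lt G).exists_of_rewrites hs'
  obtain ⟨d, h1, h2⟩ := join_of_entails hlt hG he.2.2.2
  obtain rfl := (h.subterm hp).eq_of_reflTransGen h1
  have hlt' := he.2.2.1
  rcases (groundRules_superposed hG).eq_or_lt hlt h2 with h3 | h3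
  · rw [h3] at hlt'
    exact hlt.irrefl _ hlt'
  · exact hlt.irrefl _ (hlt.trans _ _ _ hlt' h3)

theorem entails_of_reflTransGen_conv {s t : L.Term V}
    (h : ReflTransGen (Rewrites (conv lt G)) s t) :
    Entails {K | K ∈ G ∧ K.pos = true} ⟨true, s(s, t)⟩ := by
  induction h with
  | refl => exact Entails.refl _ _
  | tail _ h ih =>
    obtain ⟨e, he, p, hp, rfl⟩ := (groundRules_conv lt G).exists_of_rewrites h
    exact ih.trans (Entails.replaceAt hp he.2.2.2.symm).symm

end

/-! ## Lifting of ground rewriting to closures -/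

theorem Lit.mem_vars_mk {b : Bool} {s t : L.Term V} {x : V} :
    x ∈ Lit.vars (⟨b, s(s, t)⟩ : Lit L V) ↔ x ∈ SCLEQ.vars s ∨ x ∈ SCLEQ.vars t := by
  simp [Lit.vars]

theorem Lit.subst_subst (K : Lit L V) (σ τ : Subst L V) :
    (K.subst σ).subst τ = K.subst (σ.comp τ) := by
  obtain ⟨b, s, t, rfl⟩ := K.exists_eq
  simp only [Lit.subst_mk, SCLEQ.subst_subst]

theorem Lit.subst_congr {K : Lit L V} {σ τ : Subst L V} (h : ∀ x ∈ K.vars, σ x = τ x) :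
    K.subst σ = K.subst τ := by
  obtain ⟨b, s, t, rfl⟩ := K.exists_eq
  simp only [Lit.mem_vars_mk] at h
  rw [Lit.subst_mk, Lit.subst_mk, SCLEQ.subst_congr fun x hx => h x (Or.inl hx),
    SCLEQ.subst_congr fun x hx => h x (Or.inr hx)]

theorem Lit.mem_vars_subst {K : Lit L V} {σ : Subst L V} {y : V} :
    y ∈ (K.subst σ).vars ↔ ∃ x ∈ K.vars, y ∈ SCLEQ.vars (σ x) := by
  obtain ⟨b, s, t, rfl⟩ := K.exists_eq
  simp only [Lit.subst_mk, Lit.mem_vars_mk, SCLEQ.mem_vars_subst, or_and_right, exists_or]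

theorem Clause.mem_vars_subst {C : Clause L V} {σ : Subst L V} {y : V} :
    y ∈ Clause.vars (Clause.subst C σ) ↔ ∃ x ∈ Clause.vars C, y ∈ SCLEQ.vars (σ x) := by
  constructor
  · rintro ⟨K, hK, hy⟩
    obtain ⟨H, hH, rfl⟩ := Multiset.mem_map.1 hK
    obtain ⟨x, hx, hy⟩ := Lit.mem_vars_subst.1 hy
    exact ⟨x, ⟨H, hH, hx⟩, hy⟩
  · rintro ⟨x, ⟨K, hK, hx⟩, hy⟩
    exact ⟨K.subst σ, Multiset.mem_map_of_mem _ hK, Lit.mem_vars_subst.2 ⟨x, hx, hy⟩⟩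

theorem Clause.finite_vars (C : Clause L V) : (Clause.vars C).Finite := by
  have : Clause.vars C = ⋃ K ∈ {K | K ∈ C}, Lit.vars K := by
    ext x; simp [Clause.vars]
  rw [this]
  refine Set.Finite.biUnion ?_ ?_
  · classical
    exact (C.toFinset.finite_toSet).subset fun K hK => by simpa using hK
  · intro K _
    obtain ⟨b, s, t, rfl⟩ := K.exists_eq
    refine ((SCLEQ.finite_vars s).union (SCLEQ.finite_vars t)).subset fun x hx => ?_
    exact Lit.mem_vars_mk.1 hx

theorem Lit.vars_subset_closure (c : Closure L V) : c.lit.vars ⊆ c.vars :=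
  fun _ hx => ⟨c.lit, Multiset.mem_cons_self _ _, hx⟩

theorem exists_lit_of_subst_eq {K : Lit L V} {σ : Subst L V} {b : Bool} {s t : L.Term V}
    (h : K.subst σ = ⟨b, s(s, t)⟩) :
    ∃ s' t', K = ⟨b, s(s', t')⟩ ∧ s'.subst σ = s ∧ t'.subst σ = t := by
  obtain ⟨b', s', t', rfl⟩ := K.exists_eq
  rw [Lit.subst_mk, Lit.mk.injEq, Sym2.eq_iff] at h
  obtain ⟨rfl, ⟨h1, h2⟩ | ⟨h1, h2⟩⟩ := h
  · exact ⟨s', t', rfl, h1, h2⟩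
  · exact ⟨t', s', by rw [Sym2.eq_swap], h2, h1⟩

theorem exists_perm_avoiding [Infinite V] {A B : Set V} (hA : A.Finite) (hB : B.Finite) :
    ∃ π : Equiv.Perm V, ∀ x ∈ B, π x ∉ A := by
  classical
  induction B, hB using Set.Finite.induction_on with
  | empty => exact ⟨Equiv.refl V, by simp⟩
  | @insert x B hx hB ih =>
    obtain ⟨π, hπ⟩ := ih
    obtain ⟨y, hy⟩ := (hA.union (hB.image π)).exists_notMem
    simp only [Set.mem_union, Set.mem_image, not_or, not_exists, not_and] at hy
    -- The value at `x` is exchanged with a fresh `y`. As `y` is not a value of `π` on `B`, the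
    -- values there stay as they are.
    refine ⟨π.trans (Equiv.swap (π x) y), fun z hz => ?_⟩
    rcases hz with rfl | hz
    · simpa using hy.1
    · rw [Equiv.trans_apply, Equiv.swap_apply_of_ne_of_ne]
      · exact hπ z hz
      · intro h
        rw [π.injective h] at hz
        exact hx hz
      · exact hy.2 z hz

theorem exists_isVariant [Infinite V] (c : Closure L V) {A : Set V} (hA : A.Finite) :
    ∃ c' : Closure L V, IsVariant c c' ∧ Disjoint c'.vars A ∧ c'.glit = c.glit := by
  classical
  obtain ⟨π, hπ⟩ := exists_perm_avoiding hA (Clause.finite_vars c.clause)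
  let ren : Subst L V := fun x => Term.var (π x)
  -- The transported substitution is cut down to the renamed clause, so two variable disjoint
  -- variants do not interfere when their substitutions are composed.
  let sub : Subst L V := fun y => if π.symm y ∈ c.vars then c.sub (π.symm y) else Term.var y
  let c' : Closure L V := ⟨c.lit.subst ren, Clause.subst c.rest ren, sub⟩
  have hsub : ∀ x ∈ c.vars, sub (π x) = c.sub x := fun x hx => by
    simp only [sub, Equiv.symm_apply_apply, hx, if_true]
  have hcl : c'.clause = Clause.subst c.clause ren := by
    simp [c', Closure.clause, Clause.subst]
  have hvars : ∀ y, y ∈ c'.vars ↔ ∃ x ∈ c.vars, y = π x := by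
    intro y
    rw [Closure.vars, hcl, Clause.mem_vars_subst]
    simp [ren, vars, Closure.vars]
  refine ⟨c', ⟨π, rfl, rfl, hsub, ?_⟩, ?_, ?_⟩
  · intro y hy
    refine (hvars y).2 ⟨π.symm y, ?_, by simp⟩
    by_contra h
    exact hy (by simp only [c', sub, h, if_false])
  · rw [Set.disjoint_left]
    intro y hy
    obtain ⟨x, hx, rfl⟩ := (hvars y).1 hy
    exact hπ x hx
  · change (c.lit.subst ren).subst sub = c.lit.subst c.sub
    rw [Lit.subst_subst]
    exact Lit.subst_congr fun x hx => hsub x (Lit.vars_subset_closure c hx)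

theorem exists_injective_avoiding [Infinite V] {A : Set V} (hA : A.Finite) :
    ∃ f : List ℕ → V, Function.Injective f ∧ ∀ q, f q ∉ A := by
  have : Infinite (Aᶜ : Set V) := hA.infinite_compl.to_subtype
  let g := Infinite.natEmbedding (Aᶜ : Set V)
  refine ⟨fun q => g (Encodable.encode q), fun q q' h => ?_, fun q => (g _).2⟩
  exact Encodable.encode_injective (g.injective (Subtype.ext h))

/-- The lifting lemma. After renaming apart, the composed substitution unifies the subterm to be
rewritten with `l₁`, so an mgu exists, and by `IsMGU.comp_eq` the conclusion has the rewritten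
ground literal as its instance. If the position lies below a variable `x`, then `x` is first
expanded to the skeleton of its value with fresh variables. -/
theorem exists_rewriteInference [Infinite V] {lt : L.Term V → L.Term V → Prop}
    {I₁ I₂ : RStep L V} {b : Bool} {l r s t : L.Term V} {p : List ℕ}
    (h₁ : I₁.closure.glit = ⟨true, s(l, r)⟩) (h₂ : I₂.closure.glit = ⟨b, s(s, t)⟩)
    (hl : vars l = ∅) (hr : vars r = ∅) (hs : vars s = ∅) (ht : vars t = ∅)
    (hlr : lt r l) (hp : subtermAt s p = some l) :
    ∃ I₃, IsRewriteInference lt I₁ I₂ I₃ ∧ I₃.closure.glit = ⟨b, s(replaceAt s p r, t)⟩ := by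
  obtain ⟨c₂, hv₂, -, hg₂⟩ := exists_isVariant I₂.closure (Set.finite_empty (α := V))
  obtain ⟨c₁, hv₁, hdisj, hg₁⟩ := exists_isVariant I₁.closure (Clause.finite_vars c₂.clause)
  have hdom₁ : c₁.sub.dom ⊆ c₁.vars := hv₁.choose_spec.2.2.2
  have hdom₂ : c₂.sub.dom ⊆ c₂.vars := hv₂.choose_spec.2.2.2
  obtain ⟨l₁, r₁, hc₁, rfl, rfl⟩ := exists_lit_of_subst_eq (hg₁.trans h₁)
  obtain ⟨l₂, r₂, hc₂, rfl, rfl⟩ := exists_lit_of_subst_eq (hg₂.trans h₂)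
  have hl₂ : vars l₂ ⊆ c₂.vars := fun x hx =>
    Lit.vars_subset_closure c₂ (by rw [hc₂]; exact Lit.mem_vars_mk.2 (Or.inl hx))
  have hr₂ : vars r₂ ⊆ c₂.vars := fun x hx =>
    Lit.vars_subset_closure c₂ (by rw [hc₂]; exact Lit.mem_vars_mk.2 (Or.inr hx))
  have hsub₁ : ∀ u : L.Term V, Disjoint (vars u) c₁.vars → u.subst c₁.sub = u := fun u hu =>
    subst_eq_self fun x hx => by_contra fun h => (Set.disjoint_left.1 hu hx) (hdom₁ h)
  have hsub₂ : ∀ u : L.Term V, Disjoint (vars u) c₂.vars → u.subst c₂.sub = u := fun u hu =>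
    subst_eq_self fun x hx => by_contra fun h => (Set.disjoint_left.1 hu hx) (hdom₂ h)
  have hdisj' : ∀ u : L.Term V, vars u ⊆ c₂.vars → Disjoint (vars u) c₁.vars := fun u hu =>
    (hdisj.mono_right hu).symm
  cases hpos : subtermAt l₂ p with
  | some t₀ =>
    have ht₀ : t₀.subst c₂.sub = l₁.subst c₁.sub := by
      have := subtermAt_subst hpos c₂.sub
      rw [hp] at this
      exact (Option.some.inj this).symm
    -- The first substitution does not touch terms of `c₂`, and the second does not touch terms
    -- already grounded by the first; so the composition acts on each premise as its own
    -- substitution.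
    have e₂ : ∀ u : L.Term V, vars u ⊆ c₂.vars →
        u.subst (c₁.sub.comp c₂.sub) = u.subst c₂.sub := fun u hu => by
      rw [← subst_subst, hsub₁ u (hdisj' u hu)]
    have e₁ : ∀ u : L.Term V, vars (u.subst c₁.sub) = ∅ →
        u.subst (c₁.sub.comp c₂.sub) = u.subst c₁.sub := fun u hu => by
      rw [← subst_subst, subst_of_ground hu]
    have hunif : t₀.subst (c₁.sub.comp c₂.sub) = l₁.subst (c₁.sub.comp c₂.sub) := by
      rw [e₂ t₀ ((vars_subtermAt hpos).trans hl₂), e₁ l₁ hl, ht₀]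
    obtain ⟨μ, hμ⟩ := exists_isMGU_pair hunif
    refine ⟨_, ⟨c₁, c₂, hv₁, hv₂, hdisj, l₁, r₁, l₂, r₂, b, p, hc₁, hc₂, hlr, hp,
      Or.inl ⟨t₀, μ, hpos, hμ, rfl⟩⟩, ?_⟩
    change Lit.subst (Lit.subst _ μ) (c₁.sub.comp c₂.sub) = _
    rw [Lit.subst_subst, hμ.comp_eq (by simpa using hunif), Lit.subst_mk,
      replaceAt_subst (by simp [hpos]), e₂ l₂ hl₂, e₁ r₁ hr, e₂ r₂ hr₂]
  | none =>
    obtain ⟨q, q', x, rfl, hq⟩ :=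
      exists_var_of_subtermAt_subst (σ := c₂.sub) (u := l₂) (by simp [hp]) hpos
    have hxl : x ∈ vars l₂ := vars_subtermAt hq (by simp [vars])
    have hpos' : ∀ θ : Subst L V, subtermAt (l₂.subst θ) (q ++ q') = subtermAt (θ x) q' :=
      fun θ => by rw [subtermAt_append, subtermAt_subst hq θ]; rfl
    have hpx : subtermAt (c₂.sub x) q' = some (l₁.subst c₁.sub) := (hpos' _).symm.trans hp
    have hA : (c₁.vars ∪ c₂.vars).Finite :=
      (Clause.finite_vars c₁.clause).union (Clause.finite_vars c₂.clause)
    obtain ⟨f, hf, hfA⟩ := exists_injective_avoiding hA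
    have hext : ∀ (s' : L.Term V) (φ : Subst L V) (k : List ℕ) (a : L.Term V),
        subtermAt s' k = some a →
        Function.extend f (fun k => (subtermAt s' k).getD s') φ (f k) = a := by
      intro s' φ k a hk
      rw [hf.extend_apply, hk]; rfl
    set g := skeleton f (c₂.sub x) q' with hg
    have hgvars : vars g ⊆ Set.range f := vars_skeleton f _ _
    have hgA : Disjoint (vars g) (c₁.vars ∪ c₂.vars) := by
      rw [Set.disjoint_left]
      intro y hy
      obtain ⟨k, rfl⟩ := hgvars hy
      exact hfA k
    set δ := bind x g with hδ
    have hδdom : ∀ y ∈ δ.dom, y = x := fun y hy => by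
      by_contra h
      exact hy (bind_of_ne h g)
    have hpg : subtermAt g q' = some (Term.var (f q')) := subtermAt_skeleton f (by simp [hpx])
    have hpδ : subtermAt (l₂.subst δ) (q ++ q') = some (Term.var (f q')) := by
      rw [hpos', hδ, bind_self, hpg]
    classical
    let ρ : Subst L V := fun y => if y ∈ vars g then
      Function.extend f (fun k => (subtermAt (c₂.sub x) k).getD (c₂.sub x)) Term.var y
      else Term.var y
    have hρdom : ρ.dom ⊆ vars g := fun y hy => by
      by_contra h
      exact hy (by simp only [ρ, h, if_false])
    have hgρ : g.subst ρ = c₂.sub x := by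
      rw [subst_congr (τ := Function.extend f
        (fun k => (subtermAt (c₂.sub x) k).getD (c₂.sub x)) Term.var)
        fun y hy => by simp only [ρ, hy, if_true]]
      exact skeleton_subst f (by simp [hpx]) (subst_var _) (hext _ _)
    have hδρ : ∀ u : L.Term V, vars (u.subst c₂.sub) = ∅ →
        ((u.subst δ).subst c₂.sub).subst ρ = u.subst c₂.sub := by
      intro u hu
      rw [subst_subst, subst_subst]
      refine subst_congr fun y hy => ?_
      by_cases hyx : y = x
      · subst hyx
        simp only [Subst.comp, hδ, bind_self]
        rw [← subst_subst, hsub₂ g (hgA.mono_right Set.subset_union_right), hgρ]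
      · simp only [Subst.comp, hδ, bind_of_ne hyx]
        exact subst_of_ground (vars_subst_eq_empty.1 hu y hy) ρ
    have hmono : vars g ⊆ vars (l₂.subst δ) := fun y hy =>
      mem_vars_subst.2 ⟨x, hxl, by rwa [hδ, bind_self]⟩
    have hδvars : ∀ u : L.Term V, vars u ⊆ c₂.vars → Disjoint (vars (u.subst δ)) c₁.vars := by
      intro u hu
      rw [Set.disjoint_left]
      intro y hy
      obtain ⟨z, hz, hy⟩ := mem_vars_subst.1 hy
      by_cases hzx : z = x
      · subst hzx
        rw [hδ, bind_self] at hy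
        exact fun h => Set.disjoint_left.1 hgA hy (Or.inl h)
      · rw [hδ, bind_of_ne hzx] at hy
        rw [Set.mem_singleton_iff.1 hy]
        exact fun h => Set.disjoint_left.1 hdisj h (hu hz)
    have e₂ : ∀ u : L.Term V, vars u ⊆ c₂.vars → vars (u.subst c₂.sub) = ∅ →
        (u.subst δ).subst ((c₁.sub.comp c₂.sub).comp ρ) = u.subst c₂.sub := fun u hu hu' => by
      rw [← subst_subst, ← subst_subst, hsub₁ _ (hδvars u hu), hδρ u hu']
    have e₁ : ∀ u : L.Term V, vars (u.subst c₁.sub) = ∅ →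
        u.subst ((c₁.sub.comp c₂.sub).comp ρ) = u.subst c₁.sub := fun u hu => by
      rw [← subst_subst, ← subst_subst, subst_of_ground hu, subst_of_ground hu]
    have hunif : (Term.var (f q') : L.Term V).subst ((c₁.sub.comp c₂.sub).comp ρ) =
        l₁.subst ((c₁.sub.comp c₂.sub).comp ρ) := by
      have := subtermAt_subst hpδ ((c₁.sub.comp c₂.sub).comp ρ)
      rw [e₂ l₂ hl₂ hs, hp] at this
      rw [← Option.some.inj this, e₁ l₁ hl]
    obtain ⟨μ, hμ⟩ := exists_isMGU_pair hunif
    refine ⟨_, ⟨c₁, c₂, hv₁, hv₂, hdisj, l₁, r₁, l₂, r₂, b, q ++ q', hc₁, hc₂, hlr, hp,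
      Or.inr ⟨hpos, δ, ρ, μ, Term.var (f q'), ?_, ?_, hpδ, hδρ l₂ hs, hδρ r₂ ht, ?_, ?_, hμ,
        rfl⟩⟩, ?_⟩
    · intro y hy
      rw [hδdom y hy]
      exact Or.inl hxl
    · intro y hy
      rw [hδdom y hy, hδ, bind_self]
      exact hgA
    · exact fun y hy => ⟨Or.inl (hmono (hρdom hy)), Set.disjoint_left.1 hgA (hρdom hy)⟩
    · rintro θ hθ ⟨τ, hτ, -⟩
      rw [hpos'] at hθ
      have hτx : (θ x).subst τ = c₂.sub x := by
        rw [subst_subst] at hτ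
        exact eq_of_subst_eq hτ x hxl
      -- A competing instance `θ` factors through `δ`: fresh names go to the subterms of `θ x` at
      -- their positions, and all other variables go where `θ` sends them. The names avoid
      -- `c₂.vars`, so the two prescriptions do not collide.
      have key : ∀ u : L.Term V, vars u ⊆ c₂.vars → u.subst θ = (u.subst δ).subst
          (Function.extend f (fun k => (subtermAt (θ x) k).getD (θ x)) θ) := by
        intro u hu
        rw [subst_subst]
        refine subst_congr fun y hy => ?_
        by_cases hyx : y = x
        · subst hyx
          simp only [Subst.comp, hδ, bind_self]
          exact (skeleton_subst f hθ hτx (hext _ _)).symm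
        · simp only [Subst.comp, hδ, bind_of_ne hyx, Term.subst]
          rw [Function.extend_apply']
          rintro ⟨k, rfl⟩
          exact hfA k (Or.inr (hu hy))
      exact ⟨_, key l₂ hl₂, key r₂ hr₂⟩
    · change Lit.subst (Lit.subst _ μ) ((c₁.sub.comp c₂.sub).comp ρ) = _
      rw [Lit.subst_subst, hμ.comp_eq (by simpa using hunif), Lit.subst_mk,
        replaceAt_subst (by simp [hpδ]), e₂ l₂ hl₂ hs, e₁ r₁ hr, e₂ r₂ hr₂ ht]

/-! ## Existence of reduction chains -/

/-- The rewrite steps that can be derived from the closures in `S`. -/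
inductive Derivable (lt : L.Term V → L.Term V → Prop) (S : Set (Closure L V)) : RStep L V → Prop
  | leaf (c : Closure L V) : c ∈ S → Derivable lt S (RStep.leaf c)
  | infer (I₁ I₂ I₃ : RStep L V) : Derivable lt S I₁ → Derivable lt S I₂ →
      IsRewriteInference lt I₁ I₂ I₃ → Derivable lt S I₃

section

variable {lt : L.Term V → L.Term V → Prop} {S : Set (Closure L V)}

theorem isChain_nil : IsChain lt S [] := fun i => i.elim0

theorem IsChain.append {P Q : List (RStep L V)} (hP : IsChain lt S P) (hQ : IsChain lt S Q) :
    IsChain lt S (P ++ Q) := by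
  rintro ⟨i, hi⟩
  rw [List.length_append] at hi
  by_cases hiP : i < P.length
  · rcases hP ⟨i, hiP⟩ with ⟨c, hc, h⟩ | ⟨⟨j, hj⟩, ⟨k, hk⟩, hji, hki, h⟩
    · exact Or.inl ⟨c, hc, by simpa [List.getElem_append_left hiP] using h⟩
    · refine Or.inr ⟨⟨j, by simp; omega⟩, ⟨k, by simp; omega⟩, hji, hki, ?_⟩
      simpa [List.getElem_append_left hiP, List.getElem_append_left hj,
        List.getElem_append_left hk] using h
  · obtain ⟨i, rfl⟩ := Nat.exists_eq_add_of_le (not_lt.1 hiP)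
    rcases hQ ⟨i, by omega⟩ with ⟨c, hc, h⟩ | ⟨⟨j, hj⟩, ⟨k, hk⟩, hji, hki, h⟩
    · exact Or.inl ⟨c, hc, by simpa using h⟩
    · refine Or.inr ⟨⟨P.length + j, by simp; omega⟩, ⟨P.length + k, by simp; omega⟩, ?_, ?_, ?_⟩
      · simpa using hji
      · simpa using hki
      · simpa using h

theorem IsChain.append_leaf {P : List (RStep L V)} (hP : IsChain lt S P) {c : Closure L V}
    (hc : c ∈ S) : IsChain lt S (P ++ [RStep.leaf c]) :=
  hP.append fun i => Or.inl ⟨c, hc, by simp⟩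

theorem IsChain.append_infer {P : List (RStep L V)} (hP : IsChain lt S P) {I₁ I₂ I₃ : RStep L V}
    (h₁ : I₁ ∈ P) (h₂ : I₂ ∈ P) (h : IsRewriteInference lt I₁ I₂ I₃) :
    IsChain lt S (P ++ [I₃]) := by
  rintro ⟨i, hi⟩
  rw [List.length_append, List.length_singleton] at hi
  by_cases hiP : i < P.length
  · rcases hP ⟨i, hiP⟩ with ⟨c, hc, h⟩ | ⟨⟨j, hj⟩, ⟨k, hk⟩, hji, hki, h⟩
    · exact Or.inl ⟨c, hc, by simpa [List.getElem_append_left hiP] using h⟩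
    · refine Or.inr ⟨⟨j, by simp; omega⟩, ⟨k, by simp; omega⟩, hji, hki, ?_⟩
      simpa [List.getElem_append_left hiP, List.getElem_append_left hj,
        List.getElem_append_left hk] using h
  · obtain rfl : i = P.length := by omega
    obtain ⟨j, hj, rfl⟩ := List.mem_iff_getElem.1 h₁
    obtain ⟨k, hk, rfl⟩ := List.mem_iff_getElem.1 h₂
    refine Or.inr ⟨⟨j, by simp; omega⟩, ⟨k, by simp; omega⟩, hj, hk, ?_⟩
    simpa [List.getElem_append_left hj, List.getElem_append_left hk] using h

theorem Derivable.exists_chain {I : RStep L V} (h : Derivable lt S I) :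
    ∃ P, IsChain lt S P ∧ P.getLast? = some I := by
  induction h with
  | leaf c hc => exact ⟨[] ++ [RStep.leaf c], isChain_nil.append_leaf hc, by simp⟩
  | infer I₁ I₂ I₃ _ _ h ih₁ ih₂ =>
    obtain ⟨P, hP, hPl⟩ := ih₁
    obtain ⟨Q, hQ, hQl⟩ := ih₂
    exact ⟨(P ++ Q) ++ [I₃], (hP.append hQ).append_infer
      (List.mem_append_left _ (List.mem_of_getLast? hPl))
      (List.mem_append_right _ (List.mem_of_getLast? hQl)) h, by simp⟩

/-- Each superposition is mirrored by a lifted rewrite inference; the symmetry rule costs nothing,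
since the sides of literals are unordered. -/
theorem Superposed.exists_derivable [Infinite V] {G : Set (Lit L V)}
    (hG : ∀ K ∈ G, Lit.Ground K) (hS : ∀ K ∈ G, ∃ c ∈ S, Closure.glit c = K)
    {s t : L.Term V} (h : Superposed lt G s t) :
    ∃ I, Derivable lt S I ∧ I.closure.glit = ⟨true, s(s, t)⟩ := by
  induction h with
  | of_mem s t h =>
    obtain ⟨c, hc, hcl⟩ := hS _ h
    exact ⟨_, Derivable.leaf c hc, hcl⟩
  | symm s t _ ih =>
    rwa [Sym2.eq_swap]
  | superpose l r s t p h hlt h' hp ih ih' =>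
    obtain ⟨I₁, hI₁, h₁⟩ := ih
    obtain ⟨I₂, hI₂, h₂⟩ := ih'
    obtain ⟨I₃, h₃, hI₃⟩ := exists_rewriteInference h₁ h₂ (h.ground hG).1 (h.ground hG).2
      (h'.ground hG).1 (h'.ground hG).2 hlt hp
    exact ⟨I₃, Derivable.infer _ _ _ hI₁ hI₂ h₃, hI₃⟩

theorem exists_derivable_of_reflTransGen [Infinite V] {G : Set (Lit L V)}
    (hG : ∀ K ∈ G, Lit.Ground K) (hS : ∀ K ∈ G, ∃ c ∈ S, Closure.glit c = K) {b : Bool}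
    {s s' t : L.Term V} (hs : vars s = ∅) (ht : vars t = ∅)
    (h : ReflTransGen (Rewrites (superposedRules lt G)) s s')
    (hI : ∃ I, Derivable lt S I ∧ I.closure.glit = ⟨b, s(s, t)⟩) :
    ∃ I, Derivable lt S I ∧ I.closure.glit = ⟨b, s(s', t)⟩ := by
  have hR := groundRules_superposed (lt := lt) hG
  induction h with
  | refl => exact hI
  | tail hab hbc ih =>
    obtain ⟨I₂, hI₂, h₂⟩ := ih
    obtain ⟨e, he, p, hp, rfl⟩ := hR.exists_of_rewrites hbc
    obtain ⟨I₁, hI₁, h₁⟩ := he.1.exists_derivable hG hS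
    obtain ⟨I₃, h₃, hI₃⟩ := exists_rewriteInference h₁ h₂ (hR e he).1 (hR e he).2.1
      (hR.ground_of_reflTransGen hab hs) ht he.2 hp
    exact ⟨I₃, Derivable.infer _ _ _ hI₁ hI₂ h₃, hI₃⟩

end

theorem exists_isReductionChainApp_of_reducesTo {lt : L.Term V → L.Term V → Prop}
    {Γ : Trail L V} {c : Closure L V} {P : List (RStep L V)} (h : ReducesTo lt Γ c P) :
    ∃ P, IsReductionChainApp lt Γ c P := by
  induction hn : P.length using Nat.strong_induction_on generalizing P with
  | _ n ih =>
    by_cases hmin : ∃ i < P.length, ReducesTo lt Γ c (P.eraseIdx i)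
    · obtain ⟨i, hi, h'⟩ := hmin
      exact ih _ (by rw [List.length_eraseIdx_of_lt hi]; omega) h' rfl
    · push Not at hmin
      exact ⟨P, h, hmin⟩

/-- Every closure with a ground distinguished literal has a reduction chain application. -/
theorem exists_isReductionChainApp [Infinite V] {lt : L.Term V → L.Term V → Prop}
    (hlt : IsDesired lt) {Γ : Trail L V} (hΓ : ∀ K ∈ Trail.lits Γ, Lit.Ground K)
    {c : Closure L V} (hc : c.glit.Ground) :
    ∃ P I, IsReductionChainApp lt Γ c P ∧ P.getLast? = some I := by
  obtain ⟨b, s, t, hst⟩ := c.glit.exists_eq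
  have hst' := hc
  rw [hst, Lit.ground_mk] at hst'
  have hR := groundRules_superposed (lt := lt) hΓ
  have hS : ∀ K ∈ Trail.lits Γ, ∃ d ∈ leafSet Γ c, Closure.glit d = K := by
    rintro K ⟨a, ha, rfl⟩
    exact ⟨a.closure, Or.inr ⟨a, ha, rfl⟩, rfl⟩
  obtain ⟨s', hs1, hs2⟩ := hR.exists_normalForm hlt s
  obtain ⟨t', ht1, ht2⟩ := hR.exists_normalForm hlt t
  have hI := exists_derivable_of_reflTransGen hΓ hS hst'.1 hst'.2 hs1
    ⟨RStep.leaf c, Derivable.leaf c (Or.inl rfl), hst⟩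
  -- The sides are swapped so that the same lemma normalises the other one, and then swapped back.
  rw [Sym2.eq_swap] at hI
  have hI := exists_derivable_of_reflTransGen hΓ hS hst'.2
    (hR.ground_of_reflTransGen hs1 hst'.1) ht1 hI
  rw [Sym2.eq_swap] at hI
  obtain ⟨I, hI, hIg⟩ := hI
  obtain ⟨P, hP, hPI⟩ := hI.exists_chain
  have hmono := fun a b => Rewrites.mono (s := a) (t := b)
    (superposedRules_subset_conv (lt := lt) hΓ)
  have hred : ReducesTo lt Γ c P := ⟨hP, I, hPI, b, s, t, s', t', hst, hIg,
    ⟨ReflTransGen.mono hmono _ _ hs1, irreducible_conv hlt hΓ hs2⟩, ⟨ReflTransGen.mono hmono _ _ ht1, irreducible_conv hlt hΓ ht2⟩⟩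
  -- The chain built so far may contain superfluous steps; deleting them as long as possible yields
  -- a minimal one.
  obtain ⟨P', hP'⟩ := exists_isReductionChainApp_of_reducesTo hred
  obtain ⟨I', hI', -⟩ := hP'.1.2
  exact ⟨P', I', hP', hI'⟩

/-! ## An invariant of regular runs -/

/-- The instances below `β` of the unit equations in `N` are entailed by `G`. -/
def UnitsEntailed (lt : L.Term V → L.Term V → Prop) (N : Set (Clause L V)) (β : L.Term V)
    (G : Set (Lit L V)) : Prop :=
  ∀ l r : L.Term V, ({⟨true, s(l, r)⟩} : Clause L V) ∈ N → ∀ σ : Subst L V,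
    Lit.Ground (Lit.subst ⟨true, s(l, r)⟩ σ) → LitLtTerm lt (Lit.subst ⟨true, s(l, r)⟩ σ) β →
    Entails G (Lit.subst ⟨true, s(l, r)⟩ σ)

/-- What holds of a literal that a regular run appends to the trail `Γ`. -/
structure Appendable (lt : L.Term V → L.Term V → Prop) (N : Set (Clause L V)) (β : L.Term V)
    (Γ : Trail L V) (a : AnnLit L V) : Prop where
  ground : a.glit.Ground
  undef : ¬ Defined (Trail.lits Γ) a.glit
  irreducible : ∀ t ∈ a.glit.eqn, Irreducible (conv lt (Trail.lits Γ)) t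
  level : a.level = Trail.lastLevel Γ ∨ a.level = Trail.lastLevel Γ + 1
  units : 0 < a.level → UnitsEntailed lt N β (Trail.lits Γ)

/-- Each literal is judged only by the prefix before it, so the property survives when Skip or
Backtrack shortens the trail. -/
def TrailInv (lt : L.Term V → L.Term V → Prop) (N : Set (Clause L V)) (β : L.Term V)
    (Γ : Trail L V) : Prop :=
  ∀ (Γ₁ : Trail L V) (a : AnnLit L V) (Γ₂ : Trail L V), Γ = Γ₁ ++ a :: Γ₂ →
    Appendable lt N β Γ₁ a

structure StateInv (lt : L.Term V → L.Term V → Prop) (S : State L V) : Prop where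
  ground : vars S.β = ∅
  trail : TrailInv lt S.N S.β S.trail
  level : S.k = Trail.lastLevel S.trail

section

variable {lt : L.Term V → L.Term V → Prop} {N U : Set (Clause L V)} {β : L.Term V}
  {Γ : Trail L V}

theorem UnitsEntailed.mono {G G' : Set (Lit L V)} (h : UnitsEntailed lt N β G) (hG : G ⊆ G') :
    UnitsEntailed lt N β G' := fun l r hlr σ h1 h2 => (h l r hlr σ h1 h2).mono hG

theorem lits_append_subset (Γ Δ : Trail L V) : Trail.lits Γ ⊆ Trail.lits (Γ ++ Δ) := by
  rintro _ ⟨a, ha, rfl⟩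
  exact ⟨a, List.mem_append_left _ ha, rfl⟩

theorem trailInv_nil : TrailInv lt N β [] := by
  intro Γ₁ a Γ₂ h
  simp at h

theorem TrailInv.snoc (h : TrailInv lt N β Γ) {a : AnnLit L V} (ha : Appendable lt N β Γ a) :
    TrailInv lt N β (Γ ++ [a]) := by
  intro Γ₁ b Γ₂ he
  rcases List.eq_nil_or_concat Γ₂ with rfl | ⟨Γ₃, c, rfl⟩
  · obtain ⟨rfl, h2⟩ := List.append_inj' he rfl
    obtain rfl := List.singleton_inj.1 h2
    exact ha
  · rw [List.concat_eq_append, ← List.cons_append, ← List.append_assoc] at he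
    exact h _ _ _ (List.append_inj' he rfl).1

theorem TrailInv.of_append {Δ : Trail L V} (h : TrailInv lt N β (Γ ++ Δ)) :
    TrailInv lt N β Γ := by
  rintro Γ₁ a Γ₂ rfl
  exact h Γ₁ a (Γ₂ ++ Δ) (by simp)

theorem TrailInv.ground (h : TrailInv lt N β Γ) : ∀ K ∈ Trail.lits Γ, Lit.Ground K := by
  rintro _ ⟨a, ha, rfl⟩
  obtain ⟨Γ₁, Γ₂, rfl⟩ := List.append_of_mem ha
  exact (h _ _ _ rfl).ground

theorem lastLevel_snoc (Γ : Trail L V) (a : AnnLit L V) :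
    Trail.lastLevel (Γ ++ [a]) = a.level := by
  simp [Trail.lastLevel]

theorem TrailInv.unitsEntailed (h : TrailInv lt N β Γ) (hk : 0 < Trail.lastLevel Γ) :
    UnitsEntailed lt N β (Trail.lits Γ) := by
  rcases List.eq_nil_or_concat Γ with rfl | ⟨Γ', a, rfl⟩
  · simp [Trail.lastLevel] at hk
  · rw [List.concat_eq_append] at h hk ⊢
    rw [lastLevel_snoc] at hk
    exact ((h Γ' a [] rfl).units hk).mono (lits_append_subset _ _)

/-- If the trail entailed the complement of its last literal, then so would the prefix before it: a
model of the prefix that satisfies the last literal is a model of the trail. But that literal was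
undefined when appended. The empty trail has a one-point model. Satisfiability is what allows
`entails_positive` to pass from entailed equations to rules of `conv`. -/
theorem TrailInv.satisfiable [Nonempty V] (h : TrailInv lt N β Γ) :
    ∃ K, ¬ Entails (Trail.lits Γ) K := by
  rcases List.eq_nil_or_concat Γ with rfl | ⟨Γ', a, rfl⟩
  · obtain ⟨x⟩ := ‹Nonempty V›
    refine ⟨⟨false, s(Term.var x, Term.var x)⟩, fun h => ?_⟩
    let str : L.Structure PUnit.{max u w + 1} :=
      { funMap := fun _ _ => PUnit.unit
        RelMap := fun _ _ => False }
    have := h PUnit (fun _ => PUnit.unit) (by rintro H ⟨a, ha, -⟩; simp at ha)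
    simp [Lit.Holds] at this
  · rw [List.concat_eq_append] at h ⊢
    refine ⟨a.glit.comp, fun hK => (h Γ' a [] rfl).undef (Or.inr fun M _ _ v hM => ?_)⟩
    by_contra hc
    have ha : Lit.Holds v a.glit := by
      by_contra h'
      exact hc (holds_comp.2 h')
    refine hc (hK M v ?_)
    rintro _ ⟨d, hd, rfl⟩
    rcases List.mem_append.1 hd with hd | hd
    · exact hM _ ⟨d, hd, rfl⟩
    · rw [List.mem_singleton.1 hd]; exact ha

/-- The rules append the normal form of a literal rather than the literal itself. Its sides equal
the old ones modulo `G`, so it is still undefined. -/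
theorem IsLitNormalForm.appendable_glit {K K' : Lit L V} {G : Set (Lit L V)}
    (h : IsLitNormalForm (conv lt G) K' K) (hK : K.Ground) (hu : ¬ Defined G K) :
    K'.Ground ∧ ¬ Defined G K' ∧ ∀ t ∈ K'.eqn, Irreducible (conv lt G) t := by
  obtain ⟨b, s, t, s', t', rfl, rfl, hs, ht⟩ := h
  rw [Lit.ground_mk] at hK ⊢
  have hR := groundRules_conv lt G
  have hsub : {K | K ∈ G ∧ K.pos = true} ⊆ G := fun K hK => hK.1
  refine ⟨⟨hR.ground_of_reflTransGen hs.1 hK.1, hR.ground_of_reflTransGen ht.1 hK.2⟩, ?_, ?_⟩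
  · rwa [← defined_congr ((entails_of_reflTransGen_conv hs.1).mono hsub)
      ((entails_of_reflTransGen_conv ht.1).mono hsub)]
  · intro x hx
    rcases Sym2.mem_iff.1 hx with rfl | rfl
    · exact hs.2
    · exact ht.2

theorem IsReductionChainApp.isLitNormalForm {c : Closure L V} {P : List (RStep L V)}
    {I : RStep L V} (h : IsReductionChainApp lt Γ c P) (hI : P.getLast? = some I) :
    IsLitNormalForm (conv lt (Trail.lits Γ)) I.closure.glit c.glit := by
  obtain ⟨I', hI', h'⟩ := h.1.2
  rw [hI] at hI'
  rwa [Option.some.inj hI']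

theorem IsDesired.not_defined_of_bundef (hlt : IsDesired lt) {K : Lit L V}
    (h : BUndef lt Γ β K) (hK : LitLtTerm lt K β) : ¬ Defined (Trail.lits Γ) K :=
  h.resolve_left (hlt.not_termLtLit hK)

theorem reflTransGen_subst {R : Set (L.Term V × L.Term V)} {t : L.Term V} {σ τ : Subst L V}
    (h : ∀ x ∈ vars t, ReflTransGen (Rewrites R) (σ x) (τ x)) :
    ReflTransGen (Rewrites R) (t.subst σ) (t.subst τ) := by
  induction t with
  | var x => exact h x (by simp [vars])
  | func f ts ih =>
    exact reflTransGen_func fun i => ih i fun x hx => h x (by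
      simp only [vars, Set.mem_iUnion]; exact ⟨i, hx⟩)

/-- If neither Conflict nor Propagate is applicable, then all instances below `β` of the unit
equations are true. -/
theorem unitsEntailed_of_not_applicable [Infinite V] (hlt : IsDesired lt)
    (hΓ : ∀ K ∈ Trail.lits Γ, Lit.Ground K) {k : ℕ}
    (hc : ¬ Applicable lt Rule.conflict ⟨Γ, N, U, β, k, Status.top⟩)
    (hp : ¬ Applicable lt Rule.propagate ⟨Γ, N, U, β, k, Status.top⟩) :
    UnitsEntailed lt N β (Trail.lits Γ) := by
  classical
  intro l r hlr σ hg hβ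
  rw [Lit.subst_mk] at hg hβ ⊢
  rw [Lit.ground_mk] at hg
  rw [litLtTerm_mk] at hβ
  have hR := groundRules_conv lt (Trail.lits Γ)
  choose nf hnf using hR.exists_normalForm hlt
  -- Conflict and Propagate demand an irreducible grounding substitution, so `σ` is normalised
  -- pointwise. It is restricted to the variables of the unit to have a finite domain with
  -- irreducible values.
  let τ : Subst L V := fun x => if x ∈ vars l ∪ vars r then nf (σ x) else Term.var x
  have hτdom : τ.dom ⊆ vars l ∪ vars r := fun x hx => by
    by_contra h
    exact hx (by simp only [τ, h, if_false])
  have hτ : ∀ x ∈ vars l ∪ vars r, τ x = nf (σ x) := fun x hx => by simp only [τ, hx, if_true]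
  have hl : ReflTransGen (Rewrites (conv lt (Trail.lits Γ))) (l.subst σ) (l.subst τ) :=
    reflTransGen_subst fun x hx => by rw [hτ x (Or.inl hx)]; exact (hnf _).1
  have hr : ReflTransGen (Rewrites (conv lt (Trail.lits Γ))) (r.subst σ) (r.subst τ) :=
    reflTransGen_subst fun x hx => by rw [hτ x (Or.inr hx)]; exact (hnf _).1
  have below : ∀ {s t : L.Term V}, ReflTransGen (Rewrites (conv lt (Trail.lits Γ))) s t →
      lt s β → lt t β := fun h hs => by
    rcases hR.eq_or_lt hlt h with rfl | h
    · exact hs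
    · exact hlt.trans _ _ _ h hs
  have hsub : {K | K ∈ Trail.lits Γ ∧ K.pos = true} ⊆ Trail.lits Γ := fun K hK => hK.1
  have hirr : SubstIrreducible (conv lt (Trail.lits Γ)) τ := fun x hx => by
    rw [hτ x (hτdom hx)]; exact (hnf _).2
  have hfin : τ.dom.Finite := ((finite_vars l).union (finite_vars r)).subset hτdom
  have hgτ : Lit.Ground (Lit.subst ⟨true, s(l, r)⟩ τ) := by
    rw [Lit.subst_mk, Lit.ground_mk]
    exact ⟨hR.ground_of_reflTransGen hl hg.1, hR.ground_of_reflTransGen hr hg.2⟩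
  have hβτ : LitLtTerm lt (Lit.subst ⟨true, s(l, r)⟩ τ) β := by
    rw [Lit.subst_mk, litLtTerm_mk]
    exact ⟨below hl hβ.1, below hr hβ.2⟩
  have hground : Grounding τ ({⟨true, s(l, r)⟩} : Clause L V) := by
    refine ⟨hfin, fun K hK => ?_⟩
    rw [Clause.subst, Multiset.map_singleton, Multiset.mem_singleton] at hK
    rwa [hK]
  -- Truth carries over from the `τ`-instance to the `σ`-instance, since their sides are equal
  -- modulo the trail. The remaining cases contradict the assumptions: a false instance is a
  -- conflict, an undefined one can be propagated.
  by_cases ht : Entails (Trail.lits Γ) (Lit.subst ⟨true, s(l, r)⟩ τ)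
  · rw [Lit.subst_mk] at ht
    exact (((entails_of_reflTransGen_conv hl).mono hsub).trans ht).trans
      ((entails_of_reflTransGen_conv hr).mono hsub).symm
  exfalso
  by_cases hf : Entails (Trail.lits Γ) (Lit.comp (Lit.subst ⟨true, s(l, r)⟩ τ))
  · have hfalse : ClauseBFalse lt Γ β (Clause.subst ({⟨true, s(l, r)⟩} : Clause L V) τ) := by
      intro K hK
      rw [Clause.subst, Multiset.map_singleton, Multiset.mem_singleton] at hK
      rw [hK]
      exact ⟨hβτ, hf⟩
    by_cases h0 : ClauseHasLevel Γ (Clause.subst ({⟨true, s(l, r)⟩} : Clause L V) τ) 0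
    · exact hc ⟨_, Step.conflictBot Γ N U β k _ τ (Or.inl hlr) hground hfalse hirr h0⟩
    · exact hc ⟨_, Step.conflict Γ N U β k _ τ (Or.inl hlr) hground hfalse hirr h0⟩
  · have hid : ∀ K : Lit L V, K.subst Term.var = K := fun K => by
      obtain ⟨b, s, t, rfl⟩ := K.exists_eq
      rw [Lit.subst_mk, subst_var, subst_var]
    obtain ⟨P, I, hP, hI⟩ := exists_isReductionChainApp hlt hΓ
      (c := ⟨Lit.subst ⟨true, s(l, r)⟩ Term.var, Clause.subst 0 Term.var, τ⟩)
      (by rw [hid]; exact hgτ)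
    -- For a unit clause both `C₀` and `C₁` are empty, and the mgu of no equations is the identity.
    refine hp ⟨_, Step.propagate Γ N U β k 0 0 true l r τ Term.var P I
      (Or.inl (by simpa using hlr)) (by simpa using hground) (by simp [Clause.subst]) (by simp)
      (by simpa using isMGU_empty) (Or.inr fun h => h.elim ht hf) ?_ hirr hP hI⟩
    rw [clauseLtTerm_iff]
    intro K hK
    simp only [Clause.subst, Multiset.cons_zero, Multiset.map_singleton, hid,
      Multiset.mem_singleton] at hK
    rwa [hK]

/-- Only Propagate and Decide extend the trail. The bound `β` changes only in Grow, which also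
empties the trail, so the unit property never has to be carried over to a larger bound. -/
theorem Step.stateInv [Infinite V] (hlt : IsDesired lt) {ρ : Rule} {S S' : State L V}
    (h : Step lt ρ S S') (hS : StateInv lt S)
    (hc : ρ = Rule.decide → ¬ Applicable lt Rule.conflict S)
    (hp : ρ = Rule.decide → S.k = 0 → ¬ Applicable lt Rule.propagate S) : StateInv lt S' := by
  obtain ⟨hβ, hT, hk⟩ := hS
  cases h with
  | propagate Γ N U β k C₀ C₁ b s t σ μ P I hN hσ hC₀ hC₁ hμ hu hltβ hirr hP hI =>
    simp only at hβ hT hk ⊢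
    have hunif : μ.comp σ = σ := hμ.comp_eq (by
      rintro _ ⟨e, he, rfl | rfl⟩
      · exact (hC₁ e he).1
      · exact (hC₁ e he).2)
    have hlit : Lit.subst (Lit.subst (⟨b, s(s, t)⟩ : Lit L V) μ) σ =
        Lit.subst ⟨b, s(s, t)⟩ σ := by rw [Lit.subst_subst, hunif]
    have hbelow : LitLtTerm lt (Lit.subst (⟨b, s(s, t)⟩ : Lit L V) σ) β := by
      rw [← hlit]
      exact clauseLtTerm_iff.1 hltβ _ (Multiset.mem_map_of_mem _
        (Multiset.mem_map_of_mem _ (Multiset.mem_cons_self _ _)))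
    have hground : Lit.Ground (Lit.subst (⟨b, s(s, t)⟩ : Lit L V) σ) :=
      hσ.2 _ (Multiset.mem_map_of_mem _ (Multiset.mem_cons_self _ _))
    obtain ⟨h1, h2, h3⟩ := (hP.isLitNormalForm hI).appendable_glit
      (by change Lit.Ground (Lit.subst (Lit.subst _ μ) σ); rwa [hlit])
      (by change ¬ Defined _ (Lit.subst (Lit.subst _ μ) σ)
          rw [hlit]; exact hlt.not_defined_of_bundef hu hbelow)
    refine ⟨hβ, hT.snoc ⟨h1, h2, h3, Or.inl hk, fun h => hT.unitsEntailed ?_⟩, ?_⟩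
    · rwa [← hk]
    · simp only [lastLevel_snoc]
  | decide Γ N U β k C₀ K σ P I hN hσ hC₀ hu hltβ hirr hP hI =>
    simp only at hβ hT hk ⊢
    have hbelow : LitLtTerm lt (Lit.subst K σ) β :=
      clauseLtTerm_iff.1 hltβ _ (Multiset.mem_map_of_mem _ (Multiset.mem_cons_self _ _))
    have hground : Lit.Ground (Lit.subst K σ) :=
      hσ.2 _ (Multiset.mem_map_of_mem _ (Multiset.mem_cons_self _ _))
    obtain ⟨h1, h2, h3⟩ := (hP.isLitNormalForm hI).appendable_glit hground
      (hlt.not_defined_of_bundef hu hbelow)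
    refine ⟨hβ, hT.snoc ⟨h1, h2, h3, Or.inr (by rw [hk]), fun _ => ?_⟩, ?_⟩
    -- Regularity enters here: a Decide at level 0 establishes the unit property, and at higher
    -- levels it is inherited from the trail.
    · rcases Nat.eq_zero_or_pos k with h0 | h0
      · exact unitsEntailed_of_not_applicable hlt hT.ground (hc rfl) (hp rfl h0)
      · exact hT.unitsEntailed (hk ▸ h0)
    · simp only [lastLevel_snoc]
  | skip Γ K H N U β k D σ hH hD =>
    simp only at hβ hT hk ⊢
    refine ⟨hβ, TrailInv.of_append (Δ := [H]) (by simpa using hT), (lastLevel_snoc _ _).symm⟩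
  | backtrack Γ Γ' K N U β k i i' D H σ h1 h2 h3 h4 hi1 hi0 =>
    simp only at hβ hT hk ⊢
    refine ⟨hβ, hT.of_append, ?_⟩
    -- The level of `K` is the last level of `Γ` or one more, and it is one more exactly for
    -- decision literals; subtracting `i` therefore gives the last level of `Γ` in both cases.
    have hl := (hT Γ K Γ' rfl).level
    by_cases hK : K.level = Trail.lastLevel Γ + 1
    · have := hi1 hK
      simp only
      omega
    · have := hi0 hK
      simp only
      omega
  | grow Γ N U β β' k hβ' hlt' => exact ⟨hβ', trailInv_nil, rfl⟩
  | _ => exact ⟨hβ, hT, hk⟩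

theorem ResultsFromRegularRun.stateInv [Infinite V] (hlt : IsDesired lt) {S : State L V}
    (h : ResultsFromRegularRun lt S) : StateInv lt S := by
  obtain ⟨n, st, rl, hrun, rfl⟩ := h
  have key : ∀ i ≤ n, StateInv lt (st i) := by
    intro i
    induction i with
    | zero =>
      intro _
      obtain ⟨N, β, hβ, h0⟩ := hrun.init
      rw [h0]
      exact ⟨hβ, trailInv_nil, rfl⟩
    | succ i ih =>
      intro hi
      refine (hrun.step i hi).stateInv hlt (ih (Nat.le_of_succ_le hi)) (fun hd => ?_)
        fun hd h0 => hrun.propagateFirst i hi h0 hd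
      exact (hrun.precedence i hi (by rw [hd]; simp) (by rw [hd]; simp)).1
  exact key n le_rfl

end

/-! ## Defining literals and levels -/

/-- The literal `K` becomes defined with the `i`-th literal of `Γ`. -/
def DefinedAt (Γ : Trail L V) (K : Lit L V) (i : ℕ) : Prop :=
  ¬ Defined (Trail.lits (Γ.take i)) K ∧ Defined (Trail.lits (Γ.take (i + 1))) K

section

variable {lt : L.Term V → L.Term V → Prop} {N : Set (Clause L V)} {β : L.Term V}
  {Γ : Trail L V} {K H : Lit L V}

theorem lits_take_mono (Γ : Trail L V) {i j : ℕ} (h : i ≤ j) :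
    Trail.lits (Γ.take i) ⊆ Trail.lits (Γ.take j) := by
  rintro _ ⟨a, ha, rfl⟩
  exact ⟨a, (List.take_subset_take_left Γ h) ha, rfl⟩

theorem lits_take_subset (Γ : Trail L V) (i : ℕ) : Trail.lits (Γ.take i) ⊆ Trail.lits Γ := by
  rintro _ ⟨a, ha, rfl⟩
  exact ⟨a, List.take_subset i Γ ha, rfl⟩

theorem glit_mem_lits_take (i : Fin Γ.length) {j : ℕ} (h : i.val < j) :
    (Γ.get i).glit ∈ Trail.lits (Γ.take j) :=
  ⟨Γ.get i, List.mem_take_iff_getElem.2 ⟨i, by have := i.isLt; omega, rfl⟩, rfl⟩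

theorem exists_definedAt (h : Defined (Trail.lits Γ) K) (h0 : ¬ Defined ∅ K) :
    ∃ i : Fin Γ.length, DefinedAt Γ K i := by
  classical
  have hex : ∃ n, Defined (Trail.lits (Γ.take n)) K := ⟨Γ.length, by rwa [List.take_length]⟩
  have hpos : Nat.find hex ≠ 0 := by
    intro hz
    have := Nat.find_spec hex
    rw [hz] at this
    refine h0 (this.mono ?_)
    rintro _ ⟨a, ha, -⟩
    simp at ha
  obtain ⟨i, hi⟩ := Nat.exists_eq_succ_of_ne_zero hpos
  have hspec := Nat.find_spec hex
  have hlen : Nat.find hex ≤ Γ.length := Nat.find_min' hex (by rwa [List.take_length])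
  refine ⟨⟨i, by omega⟩, Nat.find_min hex (by simp only; omega), ?_⟩
  rw [hi] at hspec
  exact hspec

theorem DefinedAt.unique {i j : ℕ} (hi : DefinedAt Γ K i) (hj : DefinedAt Γ K j) : i = j := by
  by_contra h
  rcases Nat.lt_or_gt_of_ne h with h | h
  · exact hj.1 (hi.2.mono (lits_take_mono Γ h))
  · exact hi.1 (hj.2.mono (lits_take_mono Γ h))

theorem DefinedAt.defined {i : ℕ} (h : DefinedAt Γ K i) : Defined (Trail.lits Γ) K :=
  h.2.mono (lits_take_subset Γ _)

theorem definedAt_comp {i : ℕ} : DefinedAt Γ K.comp i ↔ DefinedAt Γ K i := by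
  simp only [DefinedAt, defined_comp]

theorem TrailInv.appendable_get (h : TrailInv lt N β Γ) (i : Fin Γ.length) :
    Appendable lt N β (Γ.take i) (Γ.get i) :=
  h (Γ.take i) (Γ.get i) (Γ.drop (i + 1)) (by simp)

theorem TrailInv.take (h : TrailInv lt N β Γ) (i : ℕ) : TrailInv lt N β (Γ.take i) :=
  TrailInv.of_append (Δ := Γ.drop i) (by rwa [List.take_append_drop])

theorem TrailInv.definedAt_get (h : TrailInv lt N β Γ) (i : Fin Γ.length) :
    DefinedAt Γ (Γ.get i).glit i :=
  ⟨(h.appendable_get i).undef, Defined.of_mem (glit_mem_lits_take i (Nat.lt_succ_self _))⟩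

theorem subLits_subset_take {Δ : Finset (Fin Γ.length)} {n : ℕ} (h : ∀ j ∈ Δ, j.val < n) :
    subLits Γ Δ ⊆ Trail.lits (Γ.take n) := by
  rintro _ ⟨j, hj, rfl⟩
  exact glit_mem_lits_take j (h j hj)

/-- `K` is undefined before `i`, so every core has an element at `i` or later. A core chosen within
the initial segment up to `i` therefore has `i` as its maximum. -/
theorem DefinedAt.isDefining {i : Fin Γ.length} (h : DefinedAt Γ K i) : IsDefining Γ K i := by
  constructor
  · have hIic : Defined (subLits Γ (Finset.Iic i)) K := by
      refine h.2.mono ?_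
      rintro _ ⟨a, ha, rfl⟩
      obtain ⟨j, hj, rfl⟩ := List.mem_take_iff_getElem.1 ha
      refine ⟨⟨j, by omega⟩, Finset.mem_Iic.2 ?_, rfl⟩
      rw [Fin.le_def]
      simp only
      omega
    obtain ⟨Δ, hΔ, hmin⟩ := exists_minimal_le_of_wellFoundedLT
      (fun Δ => Defined (subLits Γ Δ) K) _ hIic
    have hle : ∀ j ∈ Δ, j ≤ i := fun j hj => Finset.mem_Iic.1 (hΔ hj)
    refine ⟨Δ, hmin, ?_, fun j hj => hle j hj⟩
    by_contra hi
    refine h.1 (hmin.1.mono (subLits_subset_take fun j hj => ?_))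
    have := hle j hj
    have hne : j ≠ i := by rintro rfl; exact hi hj
    exact (lt_of_le_of_ne this hne : j < i)
  · intro Λ hΛ
    have hne : Λ.Nonempty := by
      rw [Finset.nonempty_iff_ne_empty]
      rintro rfl
      exact h.1 (hΛ.1.mono (subLits_subset_take (by simp)))
    refine ⟨Λ.max' hne, Λ.isGreatest_max' hne, ?_⟩
    by_contra hlt
    rw [not_le] at hlt
    refine h.1 (hΛ.1.mono (subLits_subset_take fun j hj => ?_))
    exact lt_of_le_of_lt (Λ.le_max' j hj) hlt

theorem TrailInv.hasLevel (hT : TrailInv lt N β Γ) {i : Fin Γ.length} (h : DefinedAt Γ K i) :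
    HasLevel Γ K (Γ.get i).level := by
  by_cases hK : K ∈ Trail.lits Γ
  · obtain ⟨a, ha, rfl⟩ := hK
    obtain ⟨j, rfl⟩ := List.get_of_mem ha
    obtain rfl : i = j := Fin.ext (h.unique (hT.definedAt_get j))
    exact Or.inl ⟨_, ha, rfl, rfl⟩
  · exact Or.inr ⟨hK, h.defined, Or.inl ⟨i, h.isDefining, rfl⟩⟩

/-- The empty set is then a core, so there is no defining literal. Nor can `K` be on the trail,
where each literal was undefined before it was appended. -/
theorem TrailInv.hasLevel_zero (hT : TrailInv lt N β Γ) (h : Defined ∅ K) : HasLevel Γ K 0 := by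
  have hempty : IsCore Γ K ∅ := ⟨h.mono (Set.empty_subset _), fun _ _ _ => Finset.empty_subset _⟩
  refine Or.inr ⟨?_, h.mono (Set.empty_subset _), Or.inr ⟨?_, rfl⟩⟩
  · rintro ⟨a, ha, rfl⟩
    obtain ⟨j, rfl⟩ := List.get_of_mem ha
    exact (hT.definedAt_get j).1 (h.mono (Set.empty_subset _))
  · rintro ⟨i, -, hi⟩
    obtain ⟨j, hj, -⟩ := hi ∅ hempty
    simpa using hj.1

theorem TrailInv.hasLevel_or (hT : TrailInv lt N β Γ) (h : Defined (Trail.lits Γ) K) :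
    HasLevel Γ K 0 ∨ ∃ i : Fin Γ.length, DefinedAt Γ K i ∧ 0 < (Γ.get i).level := by
  by_cases h0 : Defined ∅ K
  · exact Or.inl (hT.hasLevel_zero h0)
  · obtain ⟨i, hi⟩ := exists_definedAt h h0
    rcases Nat.eq_zero_or_pos (Γ.get i).level with hz | hz
    · exact Or.inl (hz ▸ hT.hasLevel hi)
    · exact Or.inr ⟨i, hi, hz⟩

/-! ## Rewriting with unit clauses decreases the trail induced ordering -/

/-- Literals that are equivalent modulo the units become defined at the same time, unless this
happens at level zero. -/
theorem definedAt_of_equiv {i : Fin Γ.length} {e : Lit L V}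
    (he : ∀ j : Fin Γ.length, 0 < (Γ.get j).level → Entails (Trail.lits (Γ.take j)) e)
    (heq : ∀ G, Entails G e → (Defined G K ↔ Defined G H)) (h : DefinedAt Γ H i)
    -- Positive level makes `e` true already strictly before `i`, hence also after it, so `K` and
    -- `H` agree in definedness at both prefixes.
    (hi : 0 < (Γ.get i).level) : DefinedAt Γ K i := by
  have h' := he i hi
  exact ⟨fun hK => h.1 ((heq _ h').1 hK),
    (heq _ (h'.mono (lits_take_mono Γ (Nat.le_succ _)))).2 h.2⟩

/-- The core of the proof, for single literals. The rewritten literal is always `≺_T`-smaller; what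
has to be shown is that it does not become defined later than the original one, and that the
original is not itself a trail literal of positive level or the complement of one. -/
theorem trailLt_of_unit_rewrite [Infinite V] (hlt : IsDesired lt) (hβ : vars β = ∅)
    (hT : TrailInv lt N β Γ) (hk : 0 < Trail.lastLevel Γ) {l r : L.Term V}
    (hunit : ({⟨true, s(l, r)⟩} : Clause L V) ∈ N) {σ : Subst L V}
    (hσ : Lit.Ground (Lit.subst ⟨true, s(l, r)⟩ σ)) (hlr : lt (r.subst σ) (l.subst σ))
    {b : Bool} {u t : L.Term V} {p : List ℕ} (hp : subtermAt u p = some (l.subst σ))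
    (hu : vars u = ∅) (ht : vars t = ∅) :
    TrailLt lt Γ β ⟨b, s(replaceAt u p (r.subst σ), t)⟩ ⟨b, s(u, t)⟩ := by
  rw [Lit.subst_mk, Lit.ground_mk] at hσ
  set u' := replaceAt u p (r.subst σ) with hu'
  have hu'g : vars u' = ∅ := vars_replaceAt_eq_empty hu hσ.2 p
  have hlt' : lt u' u := by
    have := hlt.context _ _ u p (by simp [hp]) hlr
    rwa [replaceAt_self hp] at this
  have hlit : LitLt lt (⟨b, s(u', t)⟩ : Lit L V) ⟨b, s(u, t)⟩ := litLt_of_lt hlt' b t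
  have hK : Lit.Ground (⟨b, s(u', t)⟩ : Lit L V) := Lit.ground_mk.2 ⟨hu'g, ht⟩
  have hH : Lit.Ground (⟨b, s(u, t)⟩ : Lit L V) := Lit.ground_mk.2 ⟨hu, ht⟩
  refine ⟨hK, hH, ?_⟩
  have hdef : ∀ M : Lit L V, M.Ground → BUndef lt Γ β M ∨ BDef lt Γ β M := by
    intro M hM
    rcases hlt.litLtTerm_or hM hβ with h | h
    · by_cases hd : Defined (Trail.lits Γ) M
      · exact Or.inr ⟨h, hd⟩
      · exact Or.inl (Or.inr hd)
    · exact Or.inl (Or.inl h)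
  rcases hdef _ hH with hHu | hHd
  · rcases hdef _ hK with hKu | hKd
    · exact TrailRel.uu _ _ hKu hHu hlit
    · exact TrailRel.du _ _ hKd hHu
  have hHβ := litLtTerm_mk.1 hHd.1
  have hKβ : LitLtTerm lt (⟨b, s(u', t)⟩ : Lit L V) β :=
    litLtTerm_mk.2 ⟨hlt.trans _ _ _ hlt' hHβ.1, hHβ.2⟩
  -- The redex is a subterm of a side below `β`, so this instance of the unit is one of those
  -- covered by `UnitsEntailed`.
  have hlβ : lt (l.subst σ) β := by
    rcases hlt.subterm_eq_or_lt hp hu with h | h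
    · rw [h]; exact hHβ.1
    · exact hlt.trans _ _ _ h hHβ.1
  have hent : ∀ {G : Set (Lit L V)}, UnitsEntailed lt N β G →
      Entails G ⟨true, s(l.subst σ, r.subst σ)⟩ := fun h =>
    h l r hunit σ (Lit.ground_mk.2 hσ) (litLtTerm_mk.2 ⟨hlβ, hlt.trans _ _ _ hlr hlβ⟩)
  have heq : ∀ G : Set (Lit L V), Entails G ⟨true, s(l.subst σ, r.subst σ)⟩ →
      (Defined G ⟨b, s(u', t)⟩ ↔ Defined G ⟨b, s(u, t)⟩) := fun G h =>
    defined_congr (Entails.replaceAt hp h.symm) (Entails.refl _ _)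
  have hunits : ∀ j : Fin Γ.length, 0 < (Γ.get j).level →
      Entails (Trail.lits (Γ.take j)) ⟨true, s(l.subst σ, r.subst σ)⟩ :=
    fun j hj => hent ((hT.appendable_get j).units hj)
  have hKd : BDef lt Γ β ⟨b, s(u', t)⟩ := ⟨hKβ, (heq _ (hent (hT.unitsEntailed hk))).2 hHd.2⟩
  by_cases hpos : ∃ i : Fin Γ.length, DefinedAt Γ ⟨b, s(u, t)⟩ i ∧ 0 < (Γ.get i).level
  swap
  · have hH0 := (hT.hasLevel_or hHd.2).resolve_right hpos
    have hK0 := (hT.hasLevel_or hKd.2).resolve_right fun ⟨i, hi, hi'⟩ =>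
      -- The transfer is symmetric: were the rewritten literal defined at positive level, so would
      -- be the original one.
      hpos ⟨i, definedAt_of_equiv hunits (fun G h => (heq G h).symm) hi hi', hi'⟩
    exact TrailRel.zz _ _ ⟨hKd, hK0⟩ ⟨hHd, hH0⟩ hlit
  obtain ⟨i, hHi, hi⟩ := hpos
  have hKi := definedAt_of_equiv hunits heq hHi hi
  have hHp : Pos lt Γ β ⟨b, s(u, t)⟩ := ⟨hHd, _, hi, hT.hasLevel hHi⟩
  have hKp : Pos lt Γ β ⟨b, s(u', t)⟩ := ⟨hKd, _, hi, hT.hasLevel hKi⟩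
  -- The unit instance is a rule of `conv` for the prefix before `i`, and it reduces `u`, whereas
  -- the sides of the `i`-th literal are irreducible there.
  have hred : u ∉ (Γ.get i).glit.eqn := fun hmem =>
    (hT.appendable_get i).irreducible u hmem _
      (rewrites_of_mem (R := conv lt (Trail.lits (Γ.take i))) (e := (l.subst σ, r.subst σ))
        ⟨hσ.1, hσ.2, hlr, entails_positive (hT.take i).satisfiable (hunits i hi)⟩ hp)
  have hget : ∀ {M : Lit L V}, DefinedAt Γ M i → M ∈ Trail.lits Γ → M = (Γ.get i).glit := by
    rintro _ hM ⟨a, ha, rfl⟩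
    obtain ⟨j, rfl⟩ := List.get_of_mem ha
    rw [Fin.ext (hM.unique (hT.definedAt_get j))]
  have hHM : IsM lt Γ β i ⟨b, s(u, t)⟩ := by
    refine ⟨hHd, fun h => hred ?_, fun h => hred ?_, hHi.isDefining⟩
    · rw [← hget hHi h]; simp
    · rw [← hget (definedAt_comp.2 hHi) h]; simp [Lit.comp]
  -- If the rewritten literal or its complement is on the trail, then at index `i`, and such
  -- literals precede all others of index `i`. Otherwise both have index `i` and `≺_T` decides.
  by_cases hK1 : (⟨b, s(u', t)⟩ : Lit L V) ∈ Trail.lits Γ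
  · exact TrailRel.lm _ _ i i hKp hHp (Or.inl (hget hKi hK1)) hHM le_rfl
  by_cases hK2 : Lit.comp (⟨b, s(u', t)⟩ : Lit L V) ∈ Trail.lits Γ
  · exact TrailRel.lm _ _ i i hKp hHp (Or.inr (hget (definedAt_comp.2 hKi) hK2)) hHM le_rfl
  · exact TrailRel.mm _ _ i i hKp hHp ⟨hKd, hK1, hK2, hKi.isDefining⟩ hHM (Or.inr ⟨rfl, hlit⟩)

end

end SCLEQ

/-! ### From literals to clauses -/

theorem mainTheorem9 {L : FirstOrder.Language} {V : Type*} [Infinite V]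
    (lt : L.Term V → L.Term V → Prop) (hlt : SCLEQ.IsDesired lt)
    (S : SCLEQ.State L V) (hS : SCLEQ.ResultsFromRegularRun lt S) (hk : 0 < S.k)
    -- the unit clause `l ≈ r`
    (l r : L.Term V) (hunit : ({⟨true, s(l, r)⟩} : SCLEQ.Clause L V) ∈ S.N)
    -- the clause `C ∨ L[l']_p` with `L = (u # t)` and `p` a position in the side `u`
    (C : SCLEQ.Clause L V) (b : Bool) (u t l' : L.Term V) (p : List ℕ)
    (hC : ((⟨b, s(u, t)⟩ : SCLEQ.Lit L V) ::ₘ C) ∈ S.N)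
    (hp : SCLEQ.subtermAt u p = some l')
    (μ : SCLEQ.Subst L V) (hμ : l' = l.subst μ)
    (σ σ' : SCLEQ.Subst L V)
    (hσ' : SCLEQ.Clause.Ground
      (SCLEQ.Clause.subst ((⟨b, s(u, t)⟩ : SCLEQ.Lit L V) ::ₘ C) σ'))
    (hσ : SCLEQ.Lit.Ground (SCLEQ.Lit.subst ⟨true, s(l, r)⟩ σ))
    (hl : l.subst σ = l'.subst σ') (hr : lt (r.subst σ) (l.subst σ)) :
    SCLEQ.TrailClauseLt lt S.trail S.β
      ((⟨b, s(SCLEQ.replaceAt (u.subst σ') p (r.subst σ), t.subst σ')⟩ : SCLEQ.Lit L V) ::ₘ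
        SCLEQ.Clause.subst C σ')
      (SCLEQ.Clause.subst ((⟨b, s(u, t)⟩ : SCLEQ.Lit L V) ::ₘ C) σ') ∧
    -- the form with `r μ σ σ'`, under the usual variable conventions
    (Disjoint (SCLEQ.vars l ∪ SCLEQ.vars r)
        (SCLEQ.Clause.vars ((⟨b, s(u, t)⟩ : SCLEQ.Lit L V) ::ₘ C)) →
      μ.dom ⊆ SCLEQ.vars l → σ.dom ⊆ SCLEQ.vars l ∪ SCLEQ.vars r →
      SCLEQ.TrailClauseLt lt S.trail S.β
        (SCLEQ.Clause.subst
          ((⟨b, s(SCLEQ.replaceAt u p (((r.subst μ).subst σ).subst σ'), t)⟩ :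
            SCLEQ.Lit L V) ::ₘ C) σ')
        (SCLEQ.Clause.subst ((⟨b, s(u, t)⟩ : SCLEQ.Lit L V) ::ₘ C) σ')) := by
  have hinv := hS.stateInv hlt
  have hup : SCLEQ.subtermAt (u.subst σ') p = some (l.subst σ) := by
    rw [SCLEQ.subtermAt_subst hp, hl]
  have hg := hσ' _ (Multiset.mem_map_of_mem _ (Multiset.mem_cons_self _ _))
  rw [SCLEQ.Lit.subst_mk, SCLEQ.Lit.ground_mk] at hg
  have main : SCLEQ.TrailClauseLt lt S.trail S.β
      ((⟨b, s(SCLEQ.replaceAt (u.subst σ') p (r.subst σ), t.subst σ')⟩ : SCLEQ.Lit L V) ::ₘ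
        SCLEQ.Clause.subst C σ')
      (SCLEQ.Clause.subst ((⟨b, s(u, t)⟩ : SCLEQ.Lit L V) ::ₘ C) σ') := by
    rw [SCLEQ.Clause.subst, SCLEQ.Clause.subst, Multiset.map_cons, SCLEQ.Lit.subst_mk]
    exact SCLEQ.mulExt_cons_of_rel (SCLEQ.trailLt_of_unit_rewrite hlt hinv.ground hinv.trail
      (hinv.level ▸ hk) hunit hσ hr hup hg.1 hg.2) _
  refine ⟨main, fun hdisj hμd hσd => ?_⟩
  -- The outer `σ'` comes from instantiating the whole clause, including the inserted term. For `x`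
  -- in `l`, the variables of `μ x` occur in `l'` and are not moved by `σ`, so the matching equation
  -- gives `(μ x)σ' = σ x`. Any other variable of `r` is fixed by `μ` and grounded by `σ`. A further
  -- `σ'` does not affect ground terms.
  have hterm : (((r.subst μ).subst σ).subst σ').subst σ' = r.subst σ := by
    rw [SCLEQ.Lit.subst_mk, SCLEQ.Lit.ground_mk] at hσ
    simp only [SCLEQ.subst_subst]
    refine SCLEQ.subst_congr fun x hx => ?_
    have hxg : SCLEQ.vars (σ x) = ∅ := SCLEQ.vars_subst_eq_empty.1 hσ.2 x hx
    simp only [SCLEQ.Subst.comp]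
    have key : ((μ x).subst σ).subst σ' = σ x := by
      by_cases hxl : x ∈ SCLEQ.vars l
      · have hσμ : (μ x).subst σ = μ x := SCLEQ.subst_eq_self fun y hy => by
          by_contra hyd
          refine Set.disjoint_left.1 hdisj (hσd hyd) ⟨_, Multiset.mem_cons_self _ _,
            SCLEQ.Lit.mem_vars_mk.2 (Or.inl (SCLEQ.vars_subtermAt hp ?_))⟩
          rw [hμ]
          exact SCLEQ.mem_vars_subst.2 ⟨x, hxl, hy⟩
        rw [hσμ]
        rw [hμ, SCLEQ.subst_subst] at hl
        exact (SCLEQ.eq_of_subst_eq hl x hxl).symm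
      · have hμx : μ x = FirstOrder.Language.Term.var x := by
          by_contra hxd
          exact hxl (hμd hxd)
        rw [hμx]
        exact SCLEQ.subst_of_ground hxg σ'
    rw [key, SCLEQ.subst_of_ground hxg]
  rw [SCLEQ.Clause.subst, Multiset.map_cons, SCLEQ.Lit.subst_mk,
    SCLEQ.replaceAt_subst (by simp [hp]), hterm]
  exact main
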